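/- For $\varepsilon>0$ and $\lambda\in\mathbb R$ consider the forced Duffing equation $$\varepsilon^{2}u''=u^{3}-\lambda u+\cos t. \tag{1}$$ Let $\lambda_0$ be the supremum of all $\lambda\ge 0$ such that $p_\lambda\bigl(-\sqrt{\lambda/3}\bigr)\le|\cos t|$ for some $t$, where $p_\lambda(u)=u^3-\lambda u$; explicitly, $\lambda_0=3/2^{2/3}$. Let $u_p$ denote the unique $2\pi$-periodic solution of (1) on $\mathbb R$ with $u'(0)=0$, $u(\pi/2)=0$ and $u'>0$ on $(0,\pi/2)$. For $\varepsilon>0$ let $$\lambda_b=\lambda_b(\varepsilon)=\sup\{\lambda\in\mathbb R : u_p \text{ is the only solution of (1) with } u'(0)=u'(\pi)=0\},$$ where "$u_p$ is the only solution with $u'(0)=u'(\pi)=0$" means that $u_p$ exists and satisfies these two conditions, and that every solution of (1) on an interval $J\supseteq[0,\pi]$ that satisfies them coincides with $u_p$ on $J$. (a) If $\lambda<\lambda_0$, then there is $\varepsilon_0>0$ (depending on $\lambda$) such that for every $\varepsilon\in(0,\varepsilon_0)$, $u_p$ is the only solution of (1) with $u'(0)=u'(\pi)=0$. (b) For every $\varepsilon>0$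 the supremum defining $\lambda_b(\varepsilon)$ is taken over a non-empty set that is bounded above, and $$\lim_{\varepsilon\to0^+}\lambda_b(\varepsilon)=\lambda_0 .$$ -/

import Mathlib

open Set Filter Topology

/-- The cubic `p_λ(u) = u³ - λ u`. -/
def cubicP (lam u : ℝ) : ℝ := u ^ 3 - lam * u

/-- `u` is a (twice differentiable) solution of `ε² u'' = u³ - λ u + cos t` on the interval `J`. At
an endpoint belonging to `J`, derivatives are one-sided. -/
def IsSolutionOn (ε lam : ℝ) (J : Set ℝ) (u : ℝ → ℝ) : Prop :=
  DifferentiableOn ℝ u J ∧ DifferentiableOn ℝ (derivWithin u J) J ∧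
    ∀ t ∈ J, ε ^ 2 * derivWithin (derivWithin u J) J t = cubicP lam (u t) + Real.cos t

/-- `u` is a solution on the interval `J` (which is meant to contain `[0, π]`) with
`u'(0) = u'(π) = 0`. -/
def IsNeumannSolutionOn (ε lam : ℝ) (J : Set ℝ) (u : ℝ → ℝ) : Prop :=
  IsSolutionOn ε lam J u ∧ derivWithin u J 0 = 0 ∧ derivWithin u J Real.pi = 0

/-- The properties that characterize the solution `u_p`: it is a `2π`-periodic solution on the whole
line with `u'(0) = 0`, `u(π/2) = 0` and `u' > 0` on `(0, π/2)`. -/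
def IsUp (ε lam : ℝ) (u : ℝ → ℝ) : Prop :=
  IsSolutionOn ε lam univ u ∧ Function.Periodic u (2 * Real.pi) ∧ deriv u 0 = 0 ∧
    u (Real.pi / 2) = 0 ∧ ∀ t ∈ Ioo 0 (Real.pi / 2), 0 < deriv u t

/-- "`u_p` is the only solution with `u'(0) = u'(π) = 0`": `u_p` exists, has these two properties,
and every solution having them, on whatever interval containing `[0, π]` it is defined (`[0, π]`
itself, or the whole line), coincides with `u_p` there. -/
def UpIsOnlySolution (ε lam : ℝ) : Prop :=
  ∃ up : ℝ → ℝ, IsUp ε lam up ∧ IsNeumannSolutionOn ε lam univ up ∧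
    ∀ J : Set ℝ, J.OrdConnected → Icc 0 Real.pi ⊆ J →
      ∀ u : ℝ → ℝ, IsNeumannSolutionOn ε lam J u → EqOn u up J

/-- The parameters `λ ≥ 0` for which the local maximum value `p_λ(-√(λ/3))` of `p_λ` is at most
`|cos t|` for some `t`. -/
def lambda0Set : Set ℝ :=
  {lam | 0 ≤ lam ∧ ∃ t : ℝ, cubicP lam (-√(lam / 3)) ≤ |Real.cos t|}

/-- The critical value `λ₀`. -/
noncomputable def lambda0 : ℝ := sSup lambda0Set

theorem isGreatest_lambda0Set : IsGreatest lambda0Set (3 / 2 ^ (2 / 3 : ℝ)) := by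
  have hpos : (0 : ℝ) < 2 ^ (2 / 3 : ℝ) := by positivity
  have hcube : ((2 : ℝ) ^ (2 / 3 : ℝ)) ^ 3 = 4 := by
    rw [← Real.rpow_natCast, ← Real.rpow_mul (by norm_num)]
    norm_num
  have key : ∀ lam : ℝ, 0 ≤ lam → cubicP lam (-√(lam / 3)) = 2 * √(lam / 3) ^ 3 := by
    intro lam h
    have hs : √(lam / 3) ^ 2 = lam / 3 := Real.sq_sqrt (by positivity)
    have hl : lam = 3 * √(lam / 3) ^ 2 := by linarith
    unfold cubicP
    generalize √(lam / 3) = s at *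
    subst hl
    ring
  have h6 : ∀ lam : ℝ, 0 ≤ lam → (√(lam / 3) ^ 3) ^ 2 = (lam / 3) ^ 3 := by
    intro lam h
    have hs : √(lam / 3) ^ 2 = lam / 3 := Real.sq_sqrt (by positivity)
    rw [← hs]; simp only [Real.sqrt_sq (Real.sqrt_nonneg _)]; ring
  constructor
  · refine ⟨by positivity, 0, ?_⟩
    rw [key _ (by positivity), Real.cos_zero, abs_one]
    have h := h6 (3 / 2 ^ (2 / 3 : ℝ)) (by positivity)
    have h2 : (3 / (2 : ℝ) ^ (2 / 3 : ℝ) / 3) ^ 3 = 1 / 4 := by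
      rw [div_right_comm, div_self (by norm_num), div_pow, hcube]; norm_num
    rw [h2] at h
    nlinarith
  · rintro lam ⟨h0, t, ht⟩
    rw [key _ h0] at ht
    have h1 := Real.abs_cos_le_one t
    have h := h6 lam h0
    have hn : 0 ≤ √(lam / 3) ^ 3 := by positivity
    have h4 : (lam / 3) ^ 3 ≤ 1 / 4 := by rw [← h]; nlinarith
    rw [le_div_iff₀ hpos]
    have : (lam * 2 ^ (2 / 3 : ℝ)) ^ 3 ≤ 3 ^ 3 := by
      rw [mul_pow, hcube]; rw [div_pow] at h4; linarith
    exact le_of_pow_le_pow_left₀ (by norm_num) (by norm_num) this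

theorem lambda0_eq : lambda0 = 3 / 2 ^ (2 / 3 : ℝ) := isGreatest_lambda0Set.csSup_eq

/-- The parameters `λ` for which `u_p` is the only solution with `u'(0) = u'(π) = 0`. -/
def uniquenessSet (ε : ℝ) : Set ℝ := {lam | UpIsOnlySolution ε lam}

/-- The first bifurcation value `λ_b`, for a given `ε`. -/
noncomputable def lambdaB (ε : ℝ) : ℝ := sSup (uniquenessSet ε)

/-! Write `e = ε²` and, for λ > 0, λ = 3s². The local maximum of p_λ is p_λ(-s) = 2s³, so λ < λ₀
means 2s³ < 1 and λ > λ₀ means 2s³ > 1. A Neumann solution is determined by u(0), so uniqueness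
reduces to that of the initial value; u_p itself exists for every λ and ε by shooting and symmetry
(`exists_symmetric_solution`).

If λ > λ₀, the force is upward at height -s and downward at a low height for all t, so shooting
between the two gives a Neumann solution that is negative on [0, π] (`exists_negative_solution`). It
is not u_p, which vanishes at π/2; hence λ_b ≤ λ₀ for every ε. If λ ≤ 0, p_λ is increasing, so the
difference of two Neumann solutions is driven away from 0 and cannot come to rest at π.

Let 0 < λ < λ₀ and let α be the leftmost root of p_λ + 1. From u(0) ≤ α a solution falls for ever;
from u(0) ≥ α + η it is expelled upwards once ε is small. So u(0) lies just above α. The energy E =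
e v²/2 - P(u) - (u - y) cos t satisfies E' = (u - y) sin t. If u had an interior turning point, E
with y the height of the next rest point would gain more than the near-minimality of P(u) + u at
u(0) permits; so u is increasing (`eventually_deriv_pos`).

Now let u₁(0) < u₂(0), with gap d. Both solutions stay below -s up to a time T independent of ε, and
spread apart there. Their energy difference gains at least d(1 - cos T), while its initial deficit
is a small multiple of d because P(u) + u is stationary at α. It is therefore positive at T, and
keeps growing as long as u₁ < u₂. The order cannot be lost, since at a meeting point u₂ would be the
faster one. The symmetry u ↦ -u(π - t) turns the same estimates into an upper bound for the energy
difference at π that is smaller than its gain on [π - T, π], a contradiction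
(`eventually_initial_not_lt`). -/

/-! ### Mean value inequalities and first zeros -/

/-- A mean value inequality: a lower bound on the derivative bounds the increment from below. -/
theorem mul_sub_le_of_le_hasDerivAt {f f' : ℝ → ℝ} {x y c : ℝ} (hxy : x ≤ y)
    (hf : ContinuousOn f (Icc x y)) (hd : ∀ t ∈ Ioo x y, HasDerivAt f (f' t) t)
    (h : ∀ t ∈ Ioo x y, c ≤ f' t) : c * (y - x) ≤ f y - f x := by
  refine (convex_Icc x y).mul_sub_le_image_sub_of_le_deriv hf ?_ ?_ x (left_mem_Icc.2 hxy) y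
    (right_mem_Icc.2 hxy) hxy <;> rw [interior_Icc]
  · exact fun t ht => (hd t ht).differentiableAt.differentiableWithinAt
  · exact fun t ht => (hd t ht).deriv ▸ h t ht

theorem mul_sub_lt_of_lt_hasDerivAt {f f' : ℝ → ℝ} {x y c : ℝ} (hxy : x < y)
    (hf : ContinuousOn f (Icc x y)) (hd : ∀ t ∈ Ioo x y, HasDerivAt f (f' t) t)
    (h : ∀ t ∈ Ioo x y, c < f' t) : c * (y - x) < f y - f x := by
  refine (convex_Icc x y).mul_sub_lt_image_sub_of_lt_deriv hf ?_ ?_ x (left_mem_Icc.2 hxy.le) y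
    (right_mem_Icc.2 hxy.le) hxy <;> rw [interior_Icc]
  · exact fun t ht => (hd t ht).differentiableAt.differentiableWithinAt
  · exact fun t ht => (hd t ht).deriv ▸ h t ht

/-- The first zero of a continuous function that is positive at the left endpoint. -/
theorem exists_first_zero {f : ℝ → ℝ} {x y : ℝ} (hf : ContinuousOn f (Icc x y)) (hx : 0 < f x)
    (h : ∃ t ∈ Icc x y, f t ≤ 0) : ∃ τ ∈ Ioc x y, f τ = 0 ∧ ∀ t ∈ Ico x τ, 0 < f t := by
  have hcl : IsClosed (Icc x y ∩ f ⁻¹' Iic 0) :=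
    hf.preimage_isClosed_of_isClosed isClosed_Icc isClosed_Iic
  have hc : IsCompact (Icc x y ∩ f ⁻¹' Iic 0) :=
    isCompact_Icc.of_isClosed_subset hcl inter_subset_left
  obtain ⟨t, ht, ht0⟩ := h
  obtain ⟨τ, ⟨hτ, hτ0⟩, hmin⟩ := hc.exists_isLeast ⟨t, ht, ht0⟩
  have hpos : ∀ r ∈ Ico x τ, 0 < f r := by
    intro r hr
    by_contra! h0
    exact absurd (hmin ⟨⟨hr.1, hr.2.le.trans hτ.2⟩, h0⟩) (not_le.2 hr.2)
  have hxτ : x < τ := lt_of_le_of_ne hτ.1 (by rintro rfl; exact absurd hτ0 (not_le.2 hx))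
  refine ⟨τ, ⟨hxτ, hτ.2⟩, le_antisymm hτ0 ?_, hpos⟩
  by_contra! hneg
  obtain ⟨r, hr, hr0⟩ := intermediate_value_Icc' hxτ.le
    (hf.mono (Icc_subset_Icc_right hτ.2)) ⟨hneg.le, hx.le⟩
  rcases hr.2.eq_or_lt with rfl | hlt
  · exact hneg.ne hr0
  · exact (hpos r ⟨hr.1, hlt⟩).ne' hr0

theorem nonpos_of_hasDerivAt_of_left_nonneg {f : ℝ → ℝ} {f' x τ : ℝ} (hx : x < τ)
    (hd : HasDerivAt f f' τ) (h0 : f τ = 0) (h : ∀ t ∈ Ioo x τ, 0 ≤ f t) : f' ≤ 0 := by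
  have := hasDerivWithinAt_iff_tendsto_slope.1 (hd.hasDerivWithinAt (s := Iio τ))
  rw [sdiff_singleton_eq_self (by simp)] at this
  refine le_of_tendsto this ?_
  filter_upwards [Ioo_mem_nhdsLT hx] with t ht
  rw [slope_def_field, h0, sub_zero]
  exact div_nonpos_of_nonneg_of_nonpos (h t ht) (by linarith [ht.2])

/-! ### Growth and escape estimates from the sign of the second derivative -/

/-- `u`, `v`, `w` are continuous on `[x, y]`, with `u' = v` and `v' = w` in the interior. -/
structure IsC2On (u v w : ℝ → ℝ) (x y : ℝ) : Prop where
  contU : ContinuousOn u (Icc x y)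
  contV : ContinuousOn v (Icc x y)
  contW : ContinuousOn w (Icc x y)
  derivU : ∀ t ∈ Ioo x y, HasDerivAt u (v t) t
  derivV : ∀ t ∈ Ioo x y, HasDerivAt v (w t) t

namespace IsC2On

variable {u v w : ℝ → ℝ} {x y : ℝ}

theorem mono (h : IsC2On u v w x y) {x' y' : ℝ} (hx : x ≤ x') (hy : y' ≤ y) :
    IsC2On u v w x' y' :=
  have hs := Icc_subset_Icc hx hy
  have hs' := Ioo_subset_Ioo hx hy
  ⟨h.contU.mono hs, h.contV.mono hs, h.contW.mono hs, fun t ht => h.derivU t (hs' ht),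
    fun t ht => h.derivV t (hs' ht)⟩

theorem neg (h : IsC2On u v w x y) :
    IsC2On (fun t => -u t) (fun t => -v t) (fun t => -w t) x y :=
  ⟨h.contU.neg, h.contV.neg, h.contW.neg, fun t ht => (h.derivU t ht).neg,
    fun t ht => (h.derivV t ht).neg⟩

theorem sub (h : IsC2On u v w x y) {u' v' w' : ℝ → ℝ} (h' : IsC2On u' v' w' x y) :
    IsC2On (fun t => u t - u' t) (fun t => v t - v' t) (fun t => w t - w' t) x y :=
  ⟨h.contU.sub h'.contU, h.contV.sub h'.contV, h.contW.sub h'.contW,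
    fun t ht => (h.derivU t ht).sub (h'.derivU t ht),
    fun t ht => (h.derivV t ht).sub (h'.derivV t ht)⟩

theorem le_of_nonneg (h : IsC2On u v w x y) (hv : ∀ t ∈ Ioo x y, 0 ≤ v t) {r t : ℝ}
    (hr : x ≤ r) (hrt : r ≤ t) (ht : t ≤ y) : u r ≤ u t := by
  have h' := h.mono hr ht
  have := mul_sub_le_of_le_hasDerivAt (c := 0) hrt h'.contU h'.derivU
    (fun s hs => hv s ⟨hr.trans_lt hs.1, hs.2.trans_le ht⟩)
  linarith

theorem lt_of_pos (h : IsC2On u v w x y) (hv : ∀ t ∈ Ioo x y, 0 < v t) {r t : ℝ}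
    (hr : x ≤ r) (hrt : r < t) (ht : t ≤ y) : u r < u t := by
  have h' := h.mono hr ht
  have := mul_sub_lt_of_lt_hasDerivAt (c := 0) hrt h'.contU h'.derivU
    (fun s hs => hv s ⟨hr.trans_lt hs.1, hs.2.trans_le ht⟩)
  linarith

theorem add_le_of_le (h : IsC2On u v w x y) {c : ℝ} (hw : ∀ t ∈ Ioo x y, c ≤ w t) {t : ℝ}
    (ht : t ∈ Icc x y) : v x + c * (t - x) ≤ v t := by
  have h' := h.mono le_rfl ht.2
  have := mul_sub_le_of_le_hasDerivAt ht.1 h'.contV h'.derivV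
    (fun s hs => hw s ⟨hs.1, hs.2.trans_le ht.2⟩)
  linarith

/-- If `u'' ≥ c` and `u' ≥ 0` at the left end, then `u` grows at least quadratically. -/
theorem quadratic_growth (h : IsC2On u v w x y) (hxy : x ≤ y) {c : ℝ} (hvx : 0 ≤ v x)
    (hw : ∀ t ∈ Ioo x y, c ≤ w t) : u x + c * (y - x) ^ 2 / 2 ≤ u y := by
  have := mul_sub_le_of_le_hasDerivAt (f := fun t => u t - c * (t - x) ^ 2 / 2)
    (f' := fun t => v t - c * (t - x)) (c := 0) hxy
    (h.contU.sub (by fun_prop)) (fun t ht => by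
      have h2 : HasDerivAt (fun t : ℝ => c * (t - x) ^ 2 / 2) (c * (t - x)) t := by
        have := ((((hasDerivAt_id' t).sub_const x).pow 2).const_mul c).div_const 2
        exact this.congr_deriv (by push_cast; ring)
      exact (h.derivU t ht).sub h2)
    (fun t ht => by linarith [h.add_le_of_le hw (Ioo_subset_Icc_self ht)])
  simp only [zero_mul, sub_self] at this
  linarith [this]

/-- Escape upwards: where `u ≥ u x`, the second derivative is at least `c > 0`. -/
theorem escape_of_pos (h : IsC2On u v w x y) {c : ℝ} (hc : 0 < c) (hvx : 0 ≤ v x)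
    (hw : ∀ t ∈ Icc x y, u x ≤ u t → c ≤ w t) :
    ∀ t ∈ Icc x y, u x ≤ u t ∧ c * (t - x) ≤ v t ∧ c ≤ w t := by
  intro t0 ht0
  have hxy : x ≤ y := ht0.1.trans ht0.2
  have key : ∀ z ∈ Icc x y, (∀ r ∈ Ioo x z, 0 ≤ w r) → u x ≤ u z := by
    intro z hz hwz
    have h' := h.mono le_rfl hz.2
    refine h'.le_of_nonneg (fun r hr => ?_) le_rfl hz.1 le_rfl
    have := h'.add_le_of_le hwz (Ioo_subset_Icc_self hr)
    linarith
  have hpos : ∀ t ∈ Icc x y, 0 < w t := by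
    by_contra! hcon
    obtain ⟨τ, hτ, hτ0, hlt⟩ := exists_first_zero h.contW
      (hc.trans_le (hw x (left_mem_Icc.2 hxy) le_rfl)) hcon
    have hτ' := Ioc_subset_Icc_self hτ
    have := hw τ hτ' (key τ hτ' fun r hr => (hlt r ⟨hr.1.le, hr.2⟩).le)
    linarith
  have hup : ∀ t ∈ Icc x y, u x ≤ u t := fun t ht =>
    key t ht fun r hr => (hpos r ⟨hr.1.le, hr.2.le.trans ht.2⟩).le
  refine ⟨hup t0 ht0, ?_, hw t0 ht0 (hup t0 ht0)⟩
  have := h.add_le_of_le (fun r hr => hw r (Ioo_subset_Icc_self hr)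
    (hup r (Ioo_subset_Icc_self hr))) ht0
  linarith

/-- Escape upwards with positive initial speed: where `u ≥ u x`, the second derivative is
nonnegative. -/
theorem escape_of_nonneg (h : IsC2On u v w x y) (hvx : 0 < v x)
    (hw : ∀ t ∈ Icc x y, u x ≤ u t → 0 ≤ w t) :
    ∀ t ∈ Icc x y, u x ≤ u t ∧ v x ≤ v t := by
  intro t0 ht0
  have hpos : ∀ t ∈ Icc x y, 0 < v t := by
    by_contra! hcon
    obtain ⟨τ, hτ, hτ0, hlt⟩ := exists_first_zero h.contV hvx hcon
    have h' := h.mono le_rfl hτ.2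
    have := h'.add_le_of_le (c := 0) (fun r hr => hw r ⟨hr.1.le, hr.2.le.trans hτ.2⟩
      (h'.le_of_nonneg (fun s hs => (hlt s ⟨hs.1.le, hs.2⟩).le) le_rfl hr.1.le hr.2.le))
      (right_mem_Icc.2 hτ.1.le)
    linarith
  have hup : ∀ t ∈ Icc x y, u x ≤ u t := fun t ht =>
    h.le_of_nonneg (fun r hr => (hpos r (Ioo_subset_Icc_self hr)).le) le_rfl ht.1 ht.2
  refine ⟨hup t0 ht0, ?_⟩
  have := h.add_le_of_le (c := 0) (fun r hr => hw r (Ioo_subset_Icc_self hr)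
    (hup r (Ioo_subset_Icc_self hr))) ht0
  linarith

theorem exists_pos_right (h : IsC2On u v w x y) (hxy : x < y) (hvx : v x = 0) (hwx : 0 < w x) :
    ∃ z ∈ Ioc x y, ∀ t ∈ Ioc x z, 0 < v t := by
  have hev : ∀ᶠ t in 𝓝[Icc x y] x, 0 < w t :=
    (h.contW x (left_mem_Icc.2 hxy.le)).eventually (lt_mem_nhds hwx)
  rw [nhdsWithin_Icc_eq_nhdsGE hxy] at hev
  obtain ⟨z, hz, hz'⟩ := mem_nhdsGE_iff_exists_Icc_subset.1 hev
  refine ⟨min z y, ⟨lt_min hz hxy, min_le_right _ _⟩, fun t ht => ?_⟩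
  have h' := h.mono le_rfl (ht.2.trans (min_le_right _ _))
  have := mul_sub_lt_of_lt_hasDerivAt (c := 0) ht.1 h'.contV h'.derivV
    (fun s hs => hz' ⟨hs.1.le, hs.2.le.trans (ht.2.trans (min_le_left _ _))⟩)
  linarith

/-- If `u` rises above the level `B ≥ u x`, then somewhere above that level it has positive
speed. -/
theorem exists_gt_of_crossing (h : IsC2On u v w x y) {B t : ℝ} (ht : t ∈ Icc x y) (hx : u x ≤ B)
    (hB : B < u t) : ∃ ξ ∈ Ioo x t, B < u ξ ∧ 0 < v ξ := by
  have h' := h.mono le_rfl ht.2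
  have hcl : IsClosed (Icc x t ∩ u ⁻¹' Iic B) :=
    h'.contU.preimage_isClosed_of_isClosed isClosed_Icc isClosed_Iic
  have hc : IsCompact (Icc x t ∩ u ⁻¹' Iic B) :=
    isCompact_Icc.of_isClosed_subset hcl inter_subset_left
  obtain ⟨τ, ⟨hτ, hτB⟩, hmax⟩ := hc.exists_isGreatest ⟨x, left_mem_Icc.2 ht.1, hx⟩
  have hτt : τ < t := lt_of_le_of_ne hτ.2 (by rintro rfl; exact absurd hτB (not_le.2 hB))
  have h2 := h'.mono hτ.1 le_rfl
  obtain ⟨ξ, hξ, hξ'⟩ := exists_hasDerivAt_eq_slope u v hτt h2.contU h2.derivU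
  refine ⟨ξ, ⟨hτ.1.trans_lt hξ.1, hξ.2⟩, ?_, ?_⟩
  · by_contra! hle
    exact absurd (hmax ⟨⟨hτ.1.trans hξ.1.le, hξ.2.le⟩, hle⟩) (not_le.2 hξ.1)
  · rw [hξ']
    have : u τ ≤ B := hτB
    exact div_pos (by linarith) (by linarith)

end IsC2On

/-! ### The Duffing equation on [0, π] and its Neumann problem -/

/-- `u` solves the Duffing equation on `[x, y]` with `e = ε²` and derivative `v`. -/
abbrev DuffingOn (e lam : ℝ) (u v : ℝ → ℝ) (x y : ℝ) : Prop :=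
  IsC2On u v (fun t => (cubicP lam (u t) + Real.cos t) / e) x y

/-- A solution on `[0, π]` with Neumann boundary conditions. -/
structure NeumannDuffing (e lam : ℝ) (u v : ℝ → ℝ) : Prop where
  sol : DuffingOn e lam u v 0 Real.pi
  left : v 0 = 0
  right : v Real.pi = 0

theorem hasDerivAt_cubicP (lam x : ℝ) : HasDerivAt (cubicP lam) (3 * x ^ 2 - lam) x := by
  have := ((hasDerivAt_id' x).pow 3).sub ((hasDerivAt_id' x).const_mul lam)
  exact this.congr_deriv (by push_cast; ring)

theorem continuous_cubicP (lam : ℝ) : Continuous (cubicP lam) := by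
  unfold cubicP; fun_prop

theorem cubicP_neg (lam x : ℝ) : cubicP lam (-x) = -cubicP lam x := by
  unfold cubicP; ring

/-- By concavity, sine lies above its chord from 0 to `y`. The linear bound serves to dominate terms
that are small compared with `t`. -/
theorem exists_mul_le_sin {y : ℝ} (h0 : 0 < y) (hy : y < Real.pi) :
    ∃ c > 0, ∀ t ∈ Icc 0 y, c * t ≤ Real.sin t := by
  have hs := Real.sin_pos_of_pos_of_lt_pi h0 hy
  refine ⟨Real.sin y / y, div_pos hs h0, fun t ht => ?_⟩
  have ha : 0 ≤ 1 - t / y := by rw [sub_nonneg, div_le_one h0]; exact ht.2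
  have h := strictConcaveOn_sin_Icc.concaveOn.2 (left_mem_Icc.2 Real.pi_pos.le) ⟨h0.le, hy.le⟩ ha
    (div_nonneg ht.1 h0.le) (sub_add_cancel 1 _)
  simp only [smul_eq_mul, mul_zero, Real.sin_zero, zero_add, div_mul_cancel₀ _ h0.ne'] at h
  calc Real.sin y / y * t = t / y * Real.sin y := by ring
    _ ≤ _ := h

namespace IsC2On

variable {e lam x y : ℝ} {u v : ℝ → ℝ}

/-- A solution at rest which is not pushed upwards starts moving downwards: the forcing `cos t` is
decreasing. -/
theorem exists_neg_right (h : DuffingOn e lam u v x y) (he : 0 < e) (hx : 0 ≤ x) (hxy : x < y)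
    (hy : y ≤ Real.pi) (hvx : v x = 0) (hw : cubicP lam (u x) + Real.cos x ≤ 0) :
    ∃ z ∈ Ioc x y, ∀ t ∈ Ioc x z, v t < 0 := by
  rcases hw.lt_or_eq with hlt | heq
  · obtain ⟨z, hz, hz'⟩ := h.neg.exists_pos_right hxy (by simpa using hvx)
      (neg_pos.2 (div_neg_of_neg_of_pos hlt he))
    exact ⟨z, hz, fun t ht => neg_pos.1 (hz' t ht)⟩
  -- If the force vanishes at `x`, its sign afterwards comes from its derivative `(3u² - λ)v - sin
  -- t`. The acceleration is continuous and zero at `x`, so `|v| ≤ μ(t - x)` for any prescribed `μ >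
  -- 0` near `x`, whereas `sin t ≥ c(t - x)`. Stopping at `y' < π` keeps `c` positive.
  obtain ⟨y', hxy', hyy'⟩ := exists_between hxy
  obtain ⟨c, hc, hsin⟩ := exists_mul_le_sin (hx.trans_lt hxy') (hyy'.trans_le hy)
  have h1 := h.mono le_rfl hyy'.le
  obtain ⟨K, hK⟩ := isCompact_Icc.exists_bound_of_continuousOn (f := fun t => 3 * u t ^ 2 - lam)
    (((h1.contU.pow 2).const_mul 3).sub continuousOn_const)
  have hK0 : 0 ≤ K := (norm_nonneg _).trans (hK x (left_mem_Icc.2 hxy'.le))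
  set μ := c / (2 * (K + 1)) with hμ
  have hμ0 : 0 < μ := by positivity
  have hKμ : K * μ ≤ c / 2 := by
    rw [hμ, ← mul_div_assoc, div_le_iff₀ (by positivity)]; nlinarith
  have hev : ∀ᶠ t in 𝓝[Icc x y'] x, |(cubicP lam (u t) + Real.cos t) / e| < μ := by
    refine ((h1.contW.abs x (left_mem_Icc.2 hxy'.le))).eventually (gt_mem_nhds ?_)
    simpa [heq] using hμ0
  rw [nhdsWithin_Icc_eq_nhdsGE hxy'] at hev
  obtain ⟨z, hz, hz'⟩ := mem_nhdsGE_iff_exists_Icc_subset.1 hev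
  have hzx : x < min z y' := lt_min hz hxy'
  have h2 := h1.mono le_rfl (min_le_right z y')
  have hvb : ∀ t ∈ Icc x (min z y'), |v t| ≤ μ * (t - x) := by
    intro t ht
    have hb : ∀ r ∈ Ioo x (min z y'), |(cubicP lam (u r) + Real.cos r) / e| < μ := fun r hr =>
      hz' ⟨hr.1.le, hr.2.le.trans (min_le_left _ _)⟩
    have a1 := h2.add_le_of_le (c := -μ) (fun r hr => (abs_lt.1 (hb r hr)).1.le) ht
    have a2 := h2.neg.add_le_of_le (c := -μ) (fun r hr => by
      have := (abs_lt.1 (hb r hr)).2; linarith) ht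
    rw [abs_le]; constructor <;> linarith
  have hN : ∀ t ∈ Ioc x (min z y'), cubicP lam (u t) + Real.cos t < 0 := by
    intro t ht
    have h3 := h2.mono le_rfl ht.2
    have := mul_sub_lt_of_lt_hasDerivAt (f := fun t => -(cubicP lam (u t) + Real.cos t))
      (f' := fun t => -((3 * u t ^ 2 - lam) * v t + -Real.sin t)) (c := 0) ht.1
      (((continuous_cubicP lam).comp_continuousOn h3.contU).add
        Real.continuous_cos.continuousOn).neg
      (fun r hr => (((hasDerivAt_cubicP lam (u r)).comp r (h3.derivU r hr)).add
        (Real.hasDerivAt_cos r)).neg) (fun r hr => by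
        have hr1 : r ∈ Icc x (min z y') := ⟨hr.1.le, hr.2.le.trans ht.2⟩
        have b1 := hvb r hr1
        have b2 := hK r ⟨hr1.1, hr1.2.trans (min_le_right _ _)⟩
        have b3 := hsin r ⟨hx.trans hr1.1, hr1.2.trans (min_le_right _ _)⟩
        have b4 : (3 * u r ^ 2 - lam) * v r ≤ K * (μ * (r - x)) :=
          (le_abs_self _).trans (by rw [abs_mul]; exact mul_le_mul b2 b1 (abs_nonneg _) hK0)
        have b5 : 0 < r - x := sub_pos.2 hr.1
        nlinarith)
    simp only [heq] at this
    linarith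
  refine ⟨min z y', ⟨hzx, (min_le_right _ _).trans hyy'.le⟩, fun t ht => ?_⟩
  have h3 := h2.mono le_rfl ht.2
  have := mul_sub_lt_of_lt_hasDerivAt (f := fun t => -v t) (c := 0) ht.1 h3.contV.neg
    (fun r hr => (h3.derivV r hr).neg)
    (fun r hr => neg_pos.2 (div_neg_of_neg_of_pos (hN r ⟨hr.1, hr.2.le.trans ht.2⟩) he))
  linarith

/-- A solution at rest, below which the force never points upwards, falls for ever. -/
theorem neg_of_forall_nonpos (h : DuffingOn e lam u v x y) (he : 0 < e) (hx : 0 ≤ x) (hxy : x < y)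
    (hy : y ≤ Real.pi) (hvx : v x = 0)
    (hw : ∀ r ≤ u x, ∀ t ∈ Icc x y, cubicP lam r + Real.cos t ≤ 0) : v y < 0 := by
  obtain ⟨z, hz, hz'⟩ := h.exists_neg_right he hx hxy hy hvx
    (hw _ le_rfl _ (left_mem_Icc.2 hxy.le))
  have hu : u z < u x := by
    have := (h.mono le_rfl hz.2).neg.lt_of_pos
      (fun t ht => neg_pos.2 (hz' t ⟨ht.1, ht.2.le⟩)) le_rfl hz.1 le_rfl
    linarith
  have hvz := hz' z (right_mem_Ioc.2 hz.1)
  have := ((h.mono hz.1.le le_rfl).neg.escape_of_nonneg (neg_pos.2 hvz) (fun t ht hut => by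
    have := hw (u t) (by linarith) t ⟨hz.1.le.trans ht.1, ht.2⟩
    exact neg_nonneg.2 (div_nonpos_of_nonpos_of_nonneg this he.le)) y (right_mem_Icc.2 hz.2)).2
  linarith

end IsC2On

namespace NeumannDuffing

variable {e lam : ℝ} {u v : ℝ → ℝ}

/-- The symmetry `u ↦ -u(π - t)` of the boundary value problem. -/
theorem reflect (h : NeumannDuffing e lam u v) :
    NeumannDuffing e lam (fun t => -u (Real.pi - t)) (fun t => v (Real.pi - t)) := by
  have hm : MapsTo (fun t => Real.pi - t) (Icc 0 Real.pi) (Icc 0 Real.pi) :=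
    fun t ht => ⟨by linarith [ht.2], by linarith [ht.1]⟩
  have hm' : ∀ t ∈ Ioo 0 Real.pi, Real.pi - t ∈ Ioo 0 Real.pi :=
    fun t ht => ⟨by linarith [ht.2], by linarith [ht.1]⟩
  have hc : ContinuousOn (fun t => Real.pi - t) (Icc 0 Real.pi) := by fun_prop
  have hd : ∀ t : ℝ, HasDerivAt (fun t => Real.pi - t) (-1) t := fun t =>
    (hasDerivAt_id' t).const_sub _
  have hw : ∀ t, (cubicP lam (-u (Real.pi - t)) + Real.cos t) / e
      = -((cubicP lam (u (Real.pi - t)) + Real.cos (Real.pi - t)) / e) := by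
    intro t; rw [cubicP_neg, Real.cos_pi_sub]; ring
  refine ⟨⟨(h.sol.contU.comp hc hm).neg, h.sol.contV.comp hc hm, ?_, fun t ht => ?_,
    fun t ht => ?_⟩, by simpa using h.right, by simpa using h.left⟩
  · simp only [hw]
    exact (h.sol.contW.comp hc hm).neg
  · exact ((h.sol.derivU _ (hm' t ht)).comp t (hd t)).neg.congr_deriv (by simp)
  · exact ((h.sol.derivV _ (hm' t ht)).comp t (hd t)).congr_deriv (by rw [hw]; simp)

/-- A Neumann solution cannot be pushed upwards for a time that is long in comparison with `ε`. -/
theorem not_pushed_up (h : NeumannDuffing e lam u v) (he : 0 < e) (hlam : lam ≤ 3) {x y c : ℝ}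
    (hx : 0 ≤ x) (hxy : x < y) (hy : y ≤ Real.pi) (hc : 0 < c) (hvx : 0 ≤ v x) (hux : -3 ≤ u x)
    (hw : ∀ r, u x ≤ r → ∀ t ∈ Icc x y, c ≤ cubicP lam r + Real.cos t)
    (hce : 12 * e ≤ c * (y - x) ^ 2) : False := by
  have h1 := h.sol.mono hx hy
  have hw' : ∀ t ∈ Icc x y, u x ≤ u t → c / e ≤ (cubicP lam (u t) + Real.cos t) / e :=
    fun t ht hut => div_le_div_of_nonneg_right (hw _ hut t ht) he.le
  have hesc := h1.escape_of_pos (div_pos hc he) hvx hw'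
  have hvy : 0 < v y := lt_of_lt_of_le (mul_pos (div_pos hc he) (sub_pos.2 hxy))
    (hesc y (right_mem_Icc.2 hxy.le)).2.1
  -- The acceleration `c / e` lifts `u` by at least 6, from -3 to 3. Above 3 the force is positive
  -- because `lam ≤ 3`, so the speed stays positive up to π.
  have huy : 3 ≤ u y := by
    have := h1.quadratic_growth hxy.le hvx
      (fun t ht => (hesc t (Ioo_subset_Icc_self ht)).2.2)
    have h6 : 12 ≤ c / e * (y - x) ^ 2 := by
      rw [div_mul_eq_mul_div, le_div_iff₀ he]; exact hce
    linarith
  have := ((h.sol.mono (hx.trans hxy.le) le_rfl).escape_of_nonneg hvy (fun t ht hut => by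
    refine div_nonneg ?_ he.le
    have h3 : 3 ≤ u t := huy.trans hut
    have h4 := Real.neg_one_le_cos t
    have h5 : 1 ≤ cubicP lam (u t) := by
      unfold cubicP
      nlinarith [mul_le_mul h3 h3 (by norm_num) (by linarith)]
    linarith) Real.pi (right_mem_Icc.2 hy)).2
  linarith [h.right]

end NeumannDuffing

/-! ### Energy -/

/-- The primitive `P` of the cubic `p_λ` with `P(0) = 0`. -/
noncomputable def quarticP (lam u : ℝ) : ℝ := u ^ 4 / 4 - lam * u ^ 2 / 2

theorem hasDerivAt_quarticP (lam x : ℝ) : HasDerivAt (quarticP lam) (cubicP lam x) x := by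
  have := (((hasDerivAt_id' x).pow 4).div_const 4).sub
    ((((hasDerivAt_id' x).pow 2).const_mul lam).div_const 2)
  exact this.congr_deriv (by unfold cubicP; push_cast; ring)

/-- The energy of a solution relative to the level `y`. -/
noncomputable def duffingEnergy (e lam y : ℝ) (u v : ℝ → ℝ) (t : ℝ) : ℝ :=
  e * v t ^ 2 / 2 - quarticP lam (u t) - (u t - y) * Real.cos t

namespace IsC2On

variable {e lam x z : ℝ} {u v : ℝ → ℝ}

/-- The equation cancels every term except the explicit time dependence of `cos t`; the level `y`
makes the rate signed while `u` stays on one side of `y`. -/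
theorem hasDerivAt_energy (h : DuffingOn e lam u v x z) (he : 0 < e) (y : ℝ) {t : ℝ}
    (ht : t ∈ Ioo x z) :
    HasDerivAt (duffingEnergy e lam y u v) ((u t - y) * Real.sin t) t := by
  have h1 := h.derivU t ht
  have h2 := h.derivV t ht
  have := ((((h2.pow 2).const_mul e).div_const 2).sub
    ((hasDerivAt_quarticP lam (u t)).comp t h1)).sub
    ((h1.sub_const y).mul (Real.hasDerivAt_cos t))
  refine this.congr_deriv ?_
  push_cast
  field_simp
  ring

theorem continuousOn_energy (h : DuffingOn e lam u v x z) (y : ℝ) :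
    ContinuousOn (duffingEnergy e lam y u v) (Icc x z) :=
  ((((h.contV.pow 2).const_mul e).div_const 2).sub
    ((continuous_iff_continuousAt.2 fun r =>
      (hasDerivAt_quarticP lam r).continuousAt).comp_continuousOn h.contU)).sub
    ((h.contU.sub continuousOn_const).mul Real.continuous_cos.continuousOn)

end IsC2On

/-! ### Subcritical case: the initial value lies near the left root -/

theorem cubicP_le_of_le_neg {s x y : ℝ} (hs : 0 < s) (hxy : x ≤ y) (hy : y ≤ -s) :
    cubicP (3 * s ^ 2) x ≤ cubicP (3 * s ^ 2) y := by
  have h : 0 ≤ x ^ 2 + x * y + y ^ 2 - 3 * s ^ 2 := by nlinarith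
  unfold cubicP
  nlinarith [mul_nonneg (sub_nonneg.2 hxy) h]

theorem cubicP_lt_of_le_neg {s x y : ℝ} (hs : 0 < s) (hxy : x < y) (hy : y ≤ -s) :
    cubicP (3 * s ^ 2) x < cubicP (3 * s ^ 2) y := by
  have h : 0 < x ^ 2 + x * y + y ^ 2 - 3 * s ^ 2 := by nlinarith
  unfold cubicP
  nlinarith [mul_pos (sub_pos.2 hxy) h]

/-- The local minimum is a double root: `p(x) + 2s³ = (x - s)²(x + 2s)`. -/
theorem neg_two_mul_cube_le_cubicP {s x : ℝ} (hx : -(2 * s) ≤ x) :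
    -(2 * s ^ 3) ≤ cubicP (3 * s ^ 2) x := by
  unfold cubicP
  nlinarith [mul_nonneg (sq_nonneg (x - s)) (by linarith : 0 ≤ x + 2 * s)]

theorem lt_one_of_two_mul_cube_lt {s : ℝ} (hs3 : 2 * s ^ 3 < 1) : s < 1 := by
  by_contra! h
  nlinarith [one_le_pow₀ h (n := 3)]

/-- `α` is the leftmost root of `p_λ + 1`, for `λ = 3 s²`. -/
structure IsLeftRoot (s α : ℝ) : Prop where
  pos : 0 < s
  small : 2 * s ^ 3 < 1
  ge : -2 ≤ α
  lt : α < -(2 * s)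
  root : cubicP (3 * s ^ 2) α = -1

/-- Intermediate values on `[-2, -2s]`, since `p(-2s) = -2s³ > -1`. -/
theorem exists_isLeftRoot {s : ℝ} (hs : 0 < s) (hs3 : 2 * s ^ 3 < 1) : ∃ α, IsLeftRoot s α := by
  have h1 := lt_one_of_two_mul_cube_lt hs3
  have h2 : cubicP (3 * s ^ 2) (-2) ≤ -1 := by unfold cubicP; nlinarith
  have h3 : -1 < cubicP (3 * s ^ 2) (-(2 * s)) := by unfold cubicP; nlinarith
  obtain ⟨α, hα, hroot⟩ := intermediate_value_Icc (by linarith : (-2 : ℝ) ≤ -(2 * s))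
    (continuous_cubicP (3 * s ^ 2)).continuousOn ⟨h2, h3.le⟩
  refine ⟨α, hs, hs3, hα.1, lt_of_le_of_ne hα.2 ?_, hroot⟩
  rintro rfl
  linarith

namespace IsLeftRoot

variable {s α e : ℝ} {u v : ℝ → ℝ}

theorem lam_le (hα : IsLeftRoot s α) : 3 * s ^ 2 ≤ 3 := by
  have h1 := lt_one_of_two_mul_cube_lt hα.small
  have := hα.pos
  nlinarith

/-- At or below `α` the force is at most `cos t - 1 ≤ 0`, so the solution would never come to rest
again. -/
theorem lt_initial (hα : IsLeftRoot s α) (he : 0 < e) (h : NeumannDuffing e (3 * s ^ 2) u v) :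
    α < u 0 := by
  by_contra! hle
  refine (h.sol.neg_of_forall_nonpos he le_rfl Real.pi_pos le_rfl h.left fun r hr t _ => ?_).ne
    h.right
  have h1 := cubicP_le_of_le_neg hα.pos (hr.trans hle) (by linarith [hα.lt, hα.pos])
  have h2 := Real.cos_le_one t
  linarith [hα.root]

theorem eventually_initial_lt (hα : IsLeftRoot s α) {η : ℝ} (hη : 0 < η) :
    ∀ᶠ e in 𝓝[>] 0, ∀ u v, NeumannDuffing e (3 * s ^ 2) u v → u 0 < α + η := by
  have hs := hα.pos
  set η' := min η s with hη'
  have hη0 : 0 < η' := lt_min hη hs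
  have hle : α + η' ≤ -s := by linarith [min_le_right η s, hα.lt]
  have hp : -1 < cubicP (3 * s ^ 2) (α + η') := by
    have := cubicP_lt_of_le_neg hs (by linarith : α < α + η') hle
    linarith [hα.root]
  -- On `[0, c]` one has `cos t ≥ 1 - c`, and `p ≥ -1 + 2c` at all heights above `α + η'`: by
  -- monotonicity up to `-s`, by the bound `-2s³` beyond. So the force is at least `c` for a time
  -- `c`, whence the threshold `c³ / 12`.
  set c := min ((cubicP (3 * s ^ 2) (α + η') + 1) / 2) ((1 - 2 * s ^ 3) / 2) with hc
  have hc0 : 0 < c := lt_min (by linarith) (by linarith [hα.small])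
  have hc1 : c ≤ (cubicP (3 * s ^ 2) (α + η') + 1) / 2 := min_le_left _ _
  have hc2 : c ≤ (1 - 2 * s ^ 3) / 2 := min_le_right _ _
  have hs0 : 0 < s ^ 3 := by positivity
  filter_upwards [Ioo_mem_nhdsGT (by positivity : (0 : ℝ) < c ^ 3 / 12)] with e he u v h
  by_contra! hcon
  have hcon' : α + η' ≤ u 0 := by linarith [min_le_left η s]
  refine h.not_pushed_up he.1 hα.lam_le le_rfl hc0 (by linarith [Real.pi_gt_three]) hc0
    h.left.ge (by linarith [hα.ge]) (fun r hr t ht => ?_) (by nlinarith [he.2])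
  have hcos : 1 - c ≤ Real.cos t := by
    have := Real.one_sub_sq_div_two_le_cos (x := t)
    nlinarith [ht.1, ht.2]
  have hpr : -1 + 2 * c ≤ cubicP (3 * s ^ 2) r := by
    rcases le_total r (-s) with hr' | hr'
    · have := cubicP_le_of_le_neg hs (hcon'.trans hr) hr'
      linarith
    · have := neg_two_mul_cube_le_cubicP (s := s) (x := r) (by linarith)
      linarith
  linarith

/-- An increasing solution cannot linger near `α`: there `p ≤ -1 + κ`, so after `τ / 2` the force is
at most `-κ`. Since `v τ ≥ 0`, integrating back from `τ` gives `v ≥ κ(τ - t)/e`, hence a rise of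
order `1/e` on `[τ/2, τ]`. -/
theorem eventually_add_le (hα : IsLeftRoot s α) {τ : ℝ} (hτ : 0 < τ) (hτπ : τ ≤ Real.pi) :
    ∃ c > 0, ∀ᶠ e in 𝓝[>] 0, ∀ u v, NeumannDuffing e (3 * s ^ 2) u v →
      (∀ t ∈ Ioo 0 τ, 0 ≤ v t) → 0 ≤ v τ → u 0 < α + c → u 0 + c ≤ u τ := by
  have hs := hα.pos
  have hcos : Real.cos (τ / 2) < 1 := by
    have := Real.strictAntiOn_cos ⟨le_rfl, Real.pi_pos.le⟩ ⟨by linarith, by linarith⟩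
      (by linarith : (0 : ℝ) < τ / 2)
    simpa using this
  set κ := (1 - Real.cos (τ / 2)) / 2 with hκ
  have hκ0 : 0 < κ := by linarith
  have hev : ∀ᶠ c in 𝓝[>] (0 : ℝ), cubicP (3 * s ^ 2) (α + 2 * c) < -1 + κ := by
    refine tendsto_nhdsWithin_of_tendsto_nhds (Continuous.tendsto (f := fun c : ℝ =>
      cubicP (3 * s ^ 2) (α + 2 * c)) ((continuous_cubicP _).comp (by fun_prop)) 0)
      |>.eventually (gt_mem_nhds ?_)
    simpa [hα.root] using hκ0
  obtain ⟨c, hc, hc0, hcs⟩ := (hev.and (Ioo_mem_nhdsGT (half_pos hs))).exists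
  refine ⟨c, hc0, ?_⟩
  filter_upwards [Ioo_mem_nhdsGT (by positivity : (0 : ℝ) < κ * (τ / 2) ^ 2 / (2 * c))]
    with e he u v h hv hvτ hu
  by_contra! hlt
  have he0 : 0 < e := he.1
  have h1 := h.sol.mono le_rfl hτπ
  have h2 := h.sol.mono (half_pos hτ).le hτπ
  have hw : ∀ t ∈ Ioo (τ / 2) τ, κ / e ≤ -((cubicP (3 * s ^ 2) (u t) + Real.cos t) / e) := by
    intro t ht
    have ht0 : 0 < t := (half_pos hτ).trans ht.1
    rw [← neg_div]
    refine div_le_div_of_nonneg_right ?_ he0.le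
    have a1 : u t ≤ u τ := h1.le_of_nonneg hv ht0.le ht.2.le le_rfl
    have a2 := cubicP_le_of_le_neg hs (by linarith : u t ≤ α + 2 * c) (by linarith [hα.lt])
    have a3 := Real.cos_le_cos_of_nonneg_of_le_pi (half_pos hτ).le
      (ht.2.le.trans hτπ) ht.1.le
    linarith
  have hvlow : ∀ t ∈ Ioo (τ / 2) τ, κ / e * (τ - t) ≤ v t := by
    intro t ht
    have h3 := (h2.mono ht.1.le le_rfl).neg.add_le_of_le
      (fun r hr => hw r ⟨ht.1.trans hr.1, hr.2⟩) (right_mem_Icc.2 ht.2.le)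
    linarith
  have hgrow := mul_sub_le_of_le_hasDerivAt (f := fun t => u t + κ / e * (τ - t) ^ 2 / 2)
    (f' := fun t => v t - κ / e * (τ - t)) (c := 0) (by linarith : τ / 2 ≤ τ)
    (h2.contU.add (by fun_prop)) (fun t ht => by
      have := ((((hasDerivAt_id' t).const_sub τ).pow 2).const_mul (κ / e)).div_const 2
      exact ((h2.derivU t ht).add this).congr_deriv (by push_cast; ring))
    (fun t ht => by linarith [hvlow t ht])
  have hu0 : u 0 ≤ u (τ / 2) := h1.le_of_nonneg hv le_rfl (half_pos hτ).le (by linarith)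
  have hbig : 2 * c < κ / e * (τ / 2) ^ 2 := by
    have := he.2
    rw [lt_div_iff₀ (by positivity)] at this
    rw [div_mul_eq_mul_div, lt_div_iff₀ he0]
    linarith
  have h4 : τ - τ / 2 = τ / 2 := by ring
  simp only [h4] at hgrow
  ring_nf at hgrow hbig hu0 hlt
  linarith

end IsLeftRoot

/-! ### Subcritical case: Neumann solutions increase -/

namespace IsLeftRoot

variable {s α : ℝ}

theorem neg_one_lt_cubicP (hα : IsLeftRoot s α) {x : ℝ} (hx : α < x) :
    -1 < cubicP (3 * s ^ 2) x := by
  have hs := hα.pos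
  rcases le_total x (-s) with h | h
  · linarith [cubicP_lt_of_le_neg hs hx h, hα.root]
  · linarith [neg_two_mul_cube_le_cubicP (s := s) (x := x) (by linarith), hα.small]

/-- `α` is a global minimizer of `P(y) + y`, whose derivative is `p + 1`. Using `p(α) = -1`, the
difference factors through `(y - α)²`, and `α < -2s` makes the cofactor positive. -/
theorem quarticP_add_ge (hα : IsLeftRoot s α) (y : ℝ) :
    quarticP (3 * s ^ 2) α + α ≤ quarticP (3 * s ^ 2) y + y := by
  have h1 : quarticP (3 * s ^ 2) y + y - (quarticP (3 * s ^ 2) α + α)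
      = (y - α) ^ 2 * ((y + α) ^ 2 + (2 * α ^ 2 - 6 * s ^ 2)) / 4 := by
    have h2 : (1 : ℝ) = -cubicP (3 * s ^ 2) α := by rw [hα.root]; ring
    calc _ = quarticP (3 * s ^ 2) y - quarticP (3 * s ^ 2) α + (y - α) * 1 := by ring
      _ = _ := by rw [h2]; unfold quarticP cubicP; ring
  have h3 : 0 ≤ 2 * α ^ 2 - 6 * s ^ 2 := by nlinarith [hα.lt, hα.pos]
  have h4 : 0 ≤ (y - α) ^ 2 * ((y + α) ^ 2 + (2 * α ^ 2 - 6 * s ^ 2)) / 4 := by positivity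
  linarith

theorem _root_.exists_quarticP_lt (s α : ℝ) {C : ℝ} (hC : 0 < C) :
    ∃ η > 0, ∀ x ∈ Ioo α (α + η),
      quarticP (3 * s ^ 2) x + x < quarticP (3 * s ^ 2) α + α + C := by
  have hc : ContinuousAt (fun x => quarticP (3 * s ^ 2) x + x) α :=
    (hasDerivAt_quarticP _ α).continuousAt.add continuousAt_id
  obtain ⟨η, hη, h⟩ := Metric.eventually_nhds_iff.1
    (hc.eventually (gt_mem_nhds (lt_add_of_pos_right _ hC)))
  refine ⟨η, hη, fun x hx => h ?_⟩
  rw [Real.dist_eq, abs_lt]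
  constructor <;> linarith [hx.1, hx.2]

/-- The derivative `p + 1` of `P(x) + x` vanishes at `α`, so its slope is arbitrarily small nearby.
-/
theorem exists_quarticP_lipschitz (hα : IsLeftRoot s α) {κ : ℝ} (hκ : 0 < κ) :
    ∃ η > 0, ∀ x y, α < x → x ≤ y → y < α + η →
      quarticP (3 * s ^ 2) y + y - (quarticP (3 * s ^ 2) x + x) ≤ κ * (y - x) := by
  obtain ⟨η, hη, h⟩ := Metric.eventually_nhds_iff.1
    ((continuous_cubicP (3 * s ^ 2)).continuousAt.eventually
      (gt_mem_nhds (show cubicP (3 * s ^ 2) α < -1 + κ by linarith [hα.root])))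
  refine ⟨η, hη, fun x y hx hxy hy => ?_⟩
  have hd : ∀ t : ℝ, HasDerivAt (fun t => -(quarticP (3 * s ^ 2) t + t))
      (-(cubicP (3 * s ^ 2) t + 1)) t := fun t =>
    ((hasDerivAt_quarticP _ t).add (hasDerivAt_id' t)).neg
  have := mul_sub_le_of_le_hasDerivAt (c := -κ) hxy
    (fun t _ => (hd t).continuousAt.continuousWithinAt) (fun t _ => hd t) (fun t ht => by
      have := h (y := t) (by
        rw [Real.dist_eq, abs_lt]
        constructor <;> linarith [ht.1, ht.2])
      linarith)
  linarith

/-- For small `ε` every Neumann solution is increasing. -/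
theorem eventually_deriv_pos (hα : IsLeftRoot s α) :
    ∀ᶠ e in 𝓝[>] 0, ∀ u v, NeumannDuffing e (3 * s ^ 2) u v → ∀ t ∈ Ioo 0 Real.pi, 0 < v t := by
  have hs := hα.pos
  have hs0 : 0 < s ^ 3 := by positivity
  -- Before time `θ` the force is upward at every height `u ≥ -2s`, because `p ≥ -2s³ = -cos θ`
  -- there.
  set θ := Real.arccos (2 * s ^ 3) with hθ
  have hcosθ : Real.cos θ = 2 * s ^ 3 := Real.cos_arccos (by linarith) hα.small.le
  have hθ0 : 0 < θ := Real.arccos_pos.2 hα.small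
  have hθπ : θ ≤ Real.pi := Real.arccos_le_pi _
  obtain ⟨c, hc, hrise⟩ := hα.eventually_add_le (half_pos hθ0) (by linarith)
  have hCcos : Real.cos θ < Real.cos (θ / 2) :=
    Real.cos_lt_cos_of_nonneg_of_le_pi (by linarith) hθπ (by linarith)
  obtain ⟨η, hη, hQ⟩ := exists_quarticP_lt s α (mul_pos hc (sub_pos.2 hCcos))
  filter_upwards [hrise, hα.eventually_initial_lt hc, hα.eventually_initial_lt hη,
    self_mem_nhdsWithin] with e hrise hac haη (he : 0 < e) u v h
  replace hac := hac u v h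
  replace haη := haη u v h
  have ha := hα.lt_initial he h
  obtain ⟨z, hz, hz'⟩ := h.sol.exists_pos_right Real.pi_pos h.left
    (div_pos (by rw [Real.cos_zero]; linarith [hα.neg_one_lt_cubicP ha]) he)
  by_contra! hcon
  obtain ⟨t, ht, htv⟩ := hcon
  have hzt : z < t := by
    by_contra! hle
    linarith [hz' t ⟨ht.1, hle⟩]
  obtain ⟨t3, ht3, hv3, hpos3⟩ := exists_first_zero (y := t)
    (h.sol.contV.mono (Icc_subset_Icc hz.1.le ht.2.le)) (hz' z (right_mem_Ioc.2 hz.1))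
    ⟨t, right_mem_Icc.2 hzt.le, htv⟩
  have h03 : 0 < t3 := hz.1.trans ht3.1
  have h3π : t3 < Real.pi := ht3.2.trans_lt ht.2
  have hpos : ∀ r ∈ Ioo 0 t3, 0 < v r := by
    intro r hr
    rcases le_total r z with hrz | hrz
    · exact hz' r ⟨hr.1, hrz⟩
    · exact hpos3 r ⟨hrz, hr.2⟩
  have hw3 : cubicP (3 * s ^ 2) (u t3) + Real.cos t3 ≤ 0 := by
    have := nonpos_of_hasDerivAt_of_left_nonneg h03 (h.sol.derivV t3 ⟨h03, h3π⟩) hv3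
      (fun r hr => (hpos r hr).le)
    by_contra! hlt
    exact absurd this (not_le.2 (div_pos hlt he))
  have hsol3 := h.sol.mono h03.le le_rfl
  -- Otherwise `p` is increasing below `u t3` and `cos` is decreasing, so the force stays
  -- nonpositive below this height and the solution falls up to π.
  have hm : -s < u t3 := by
    by_contra! hle
    refine (hsol3.neg_of_forall_nonpos he h03.le h3π le_rfl hv3 fun r hr t' ht' => ?_).ne h.right
    linarith [cubicP_le_of_le_neg hs hr hle,
      Real.cos_le_cos_of_nonneg_of_le_pi h03.le ht'.2 ht'.1]
  have hθ3 : θ ≤ t3 := by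
    by_contra! hlt
    have h1 := Real.cos_lt_cos_of_nonneg_of_le_pi h03.le hθπ hlt
    linarith [neg_two_mul_cube_le_cubicP (s := s) (x := u t3) (by linarith)]
  have hmid : u 0 + c ≤ u (θ / 2) := hrise u v h
    (fun r hr => (hpos r ⟨hr.1, by linarith [hr.2]⟩).le)
    (hpos _ ⟨half_pos hθ0, by linarith⟩).le hac
  obtain ⟨z2, hz2, hneg2⟩ := hsol3.exists_neg_right he h03.le h3π le_rfl hv3 hw3
  obtain ⟨t4, ht4, hv4, hneg4⟩ := exists_first_zero (y := Real.pi)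
    (h.sol.contV.neg.mono (Icc_subset_Icc (h03.trans hz2.1).le le_rfl))
    (neg_pos.2 (hneg2 z2 (right_mem_Ioc.2 hz2.1)))
    ⟨Real.pi, right_mem_Icc.2 hz2.2, by simp [h.right]⟩
  replace hv4 : v t4 = 0 := by simpa using hv4
  have h34 : t3 < t4 := hz2.1.trans ht4.1
  have hneg : ∀ r ∈ Ioo t3 t4, 0 < -v r := by
    intro r hr
    rcases le_total r z2 with hrz | hrz
    · exact neg_pos.2 (hneg2 r ⟨hr.1, hrz⟩)
    · exact hneg4 r ⟨hrz, hr.2⟩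
  have hup := h.sol.mono le_rfl h3π.le
  have hdown := (hsol3.mono le_rfl ht4.2).neg
  have hsol4 := h.sol.mono le_rfl ht4.2
  have hym : u t4 < u t3 := by linarith [hdown.lt_of_pos hneg le_rfl h34 le_rfl]
  have hgt : ∀ r ∈ Ico t3 t4, u t4 < u r := fun r hr => by
    linarith [hdown.lt_of_pos hneg hr.1 hr.2 le_rfl]
  have hE4 : duffingEnergy e (3 * s ^ 2) (u t4) u v t4 = -quarticP (3 * s ^ 2) (u t4) := by
    simp [duffingEnergy, hv4]
  -- If `u` passes the level `u t4` at some `τ` on the way up, the energy at `τ` is at least that at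
  -- `t4`, although it increases strictly in between. If `u` starts above that level, the energy
  -- never decreases and gains `c(cos(θ/2) - cos θ)` on `[θ/2, θ]`, too much for a start so near the
  -- minimizer `α`.
  rcases le_or_gt (u 0) (u t4) with hya | hya
  · obtain ⟨τ, hτ, huτ⟩ := intermediate_value_Icc h03.le hup.contU ⟨hya, hym.le⟩
    have hτ4 : τ < t4 := hτ.2.trans_lt h34
    have hs4 := hsol4.mono hτ.1 le_rfl
    have := mul_sub_lt_of_lt_hasDerivAt (c := 0) hτ4 (hs4.continuousOn_energy (u t4))
      (fun r hr => hs4.hasDerivAt_energy he (u t4) hr) (fun r hr => by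
        refine mul_pos (sub_pos.2 ?_) (Real.sin_pos_of_pos_of_lt_pi (hτ.1.trans_lt hr.1)
          (hr.2.trans_le ht4.2))
        rcases lt_or_ge r t3 with hr3 | hr3
        · rw [← huτ]; exact hup.lt_of_pos hpos hτ.1 hr.1 hr3.le
        · exact hgt r ⟨hr3, hr.2⟩)
    rw [hE4] at this
    simp only [duffingEnergy, huτ] at this
    nlinarith [sq_nonneg (v τ)]
  · have hge : ∀ r ∈ Icc 0 t4, u t4 ≤ u r := by
      intro r hr
      rcases le_total r t3 with hr3 | hr3
      · exact hya.le.trans (hup.le_of_nonneg (fun r hr => (hpos r hr).le) le_rfl hr.1 hr3)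
      · rcases hr.2.eq_or_lt with rfl | hr4
        · exact le_rfl
        · exact (hgt r ⟨hr3, hr4⟩).le
    have hsin : ∀ r ∈ Icc 0 t4, 0 ≤ Real.sin r := fun r hr =>
      Real.sin_nonneg_of_nonneg_of_le_pi hr.1 (hr.2.trans ht4.2)
    have hmono : ∀ x y, 0 ≤ x → x ≤ y → y ≤ t4 → 0 * (y - x) ≤
        duffingEnergy e (3 * s ^ 2) (u t4) u v y - duffingEnergy e (3 * s ^ 2) (u t4) u v x := by
      intro x y hx hxy hy
      have hs4 := hsol4.mono hx hy
      exact mul_sub_le_of_le_hasDerivAt hxy (hs4.continuousOn_energy (u t4))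
        (fun r hr => hs4.hasDerivAt_energy he (u t4) hr) (fun r hr =>
          have hr4 : r ∈ Icc 0 t4 := ⟨hx.trans hr.1.le, hr.2.le.trans hy⟩
          mul_nonneg (sub_nonneg.2 (hge r hr4)) (hsin r hr4))
    have e1 := hmono 0 (θ / 2) le_rfl (by linarith) (by linarith)
    have e3 := hmono θ t4 hθ0.le (by linarith) le_rfl
    have hs4 := hsol4.mono (by linarith : 0 ≤ θ / 2) (by linarith : θ ≤ t4)
    have e2 := mul_sub_le_of_le_hasDerivAt (c := 0) (by linarith : θ / 2 ≤ θ)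
      ((hs4.continuousOn_energy (u t4)).add (Real.continuous_cos.continuousOn.const_mul c))
      (fun r hr => (hs4.hasDerivAt_energy he (u t4) hr).add
        ((Real.hasDerivAt_cos r).const_mul c)) (fun r hr => by
        have hr4 : r ∈ Icc 0 t4 := ⟨by linarith [hr.1], by linarith [hr.2]⟩
        have := hup.le_of_nonneg (fun r hr => (hpos r hr).le) (by linarith : 0 ≤ θ / 2)
          hr.1.le (by linarith [hr.2])
        have : 0 ≤ (u r - u t4 - c) * Real.sin r :=
          mul_nonneg (by linarith) (hsin r hr4)
        linarith)
    have hE0 : duffingEnergy e (3 * s ^ 2) (u t4) u v 0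
        = -quarticP (3 * s ^ 2) (u 0) - (u 0 - u t4) := by
      simp [duffingEnergy, h.left]
    have hq := hQ (u 0) ⟨ha, haη⟩
    have hq' := hα.quarticP_add_ge (u t4)
    simp only [zero_mul, Pi.add_apply] at e1 e2 e3
    rw [hE0] at e1
    rw [hE4] at e3
    linarith

/-- For small `ε` the increasing Neumann solutions stay below the local maximum of `p_λ` for a
time that does not depend on `ε`. -/
theorem eventually_le_neg (hα : IsLeftRoot s α) :
    ∃ T ∈ Ioo 0 (Real.pi / 2), ∀ᶠ e in 𝓝[>] 0, ∀ u v, NeumannDuffing e (3 * s ^ 2) u v →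
      (∀ t ∈ Ioo 0 Real.pi, 0 < v t) → ∀ t ∈ Icc 0 T, u t ≤ -s := by
  have hs := hα.pos
  have hs0 : 0 < s ^ 3 := by positivity
  have hs1 := lt_one_of_two_mul_cube_lt hα.small
  set θ := Real.arccos (2 * s ^ 3) with hθ
  have hcosθ : Real.cos θ = 2 * s ^ 3 := Real.cos_arccos (by linarith) hα.small.le
  have hθ0 : 0 < θ := Real.arccos_pos.2 hα.small
  have hθπ : θ ≤ Real.pi / 2 := Real.arccos_le_pi_div_two.2 (by linarith)
  have hc : 0 < Real.cos (2 * θ / 3) - Real.cos θ :=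
    sub_pos.2 (Real.cos_lt_cos_of_nonneg_of_le_pi (by linarith) (by linarith) (by linarith))
  set c := Real.cos (2 * θ / 3) - Real.cos θ with hcdef
  refine ⟨θ / 3, ⟨by linarith, by linarith⟩, ?_⟩
  filter_upwards [Ioo_mem_nhdsGT (by positivity : (0 : ℝ) < c * (θ / 3) ^ 2 / 12)]
    with e he u v h hv
  -- Otherwise, on `[θ/3, 2θ/3]`, the force at every height above `-s` is at least `cos(2θ/3) - cos
  -- θ`, independently of `ε`.
  have hle : u (θ / 3) ≤ -s := by
    by_contra! hlt
    refine h.not_pushed_up he.1 hα.lam_le (x := θ / 3) (y := 2 * θ / 3) (by linarith)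
      (by linarith) (by linarith) hc (hv _ ⟨by linarith, by linarith⟩).le (by linarith)
      (fun r hr t ht => ?_) ?_
    · have h1 := neg_two_mul_cube_le_cubicP (s := s) (x := r) (by linarith)
      have h2 := Real.cos_le_cos_of_nonneg_of_le_pi (by linarith [ht.1] : 0 ≤ t)
        (by linarith : 2 * θ / 3 ≤ Real.pi) ht.2
      linarith
    · have := he.2
      rw [show 2 * θ / 3 - θ / 3 = θ / 3 by ring]
      linarith
  intro t ht
  exact (h.sol.le_of_nonneg (fun r hr => (hv r hr).le) ht.1 ht.2 (by linarith)).trans hle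

end IsLeftRoot

/-! ### Subcritical case: comparison of two Neumann solutions -/

theorem quarticP_neg (lam x : ℝ) : quarticP lam (-x) = quarticP lam x := by
  unfold quarticP; ring

/-- The energy difference has derivative `(u₂ - u₁) sin t`; the level `y` cancels, and `sin ≥ 0` on
`[0, π]`. -/
theorem IsC2On.energy_sub_ge {e lam x z y d : ℝ} {u₁ v₁ u₂ v₂ : ℝ → ℝ}
    (h₁ : DuffingOn e lam u₁ v₁ x z) (h₂ : DuffingOn e lam u₂ v₂ x z) (he : 0 < e) (hx : 0 ≤ x)
    (hxz : x ≤ z) (hz : z ≤ Real.pi) (hd : ∀ t ∈ Ioo x z, d ≤ u₂ t - u₁ t) :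
    d * (Real.cos x - Real.cos z) ≤
      duffingEnergy e lam y u₂ v₂ z - duffingEnergy e lam y u₁ v₁ z
        - (duffingEnergy e lam y u₂ v₂ x - duffingEnergy e lam y u₁ v₁ x) := by
  have := mul_sub_le_of_le_hasDerivAt (c := 0) hxz
    (((h₂.continuousOn_energy y).sub (h₁.continuousOn_energy y)).add
      (Real.continuous_cos.continuousOn.const_mul d))
    (fun t ht => ((h₂.hasDerivAt_energy he y ht).sub (h₁.hasDerivAt_energy he y ht)).add
      ((Real.hasDerivAt_cos t).const_mul d)) (fun t ht => by
      have : 0 ≤ (u₂ t - u₁ t - d) * Real.sin t :=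
        mul_nonneg (sub_nonneg.2 (hd t ht)) (Real.sin_nonneg_of_nonneg_of_le_pi
          (hx.trans ht.1.le) (ht.2.le.trans hz))
      linarith)
  simp only [zero_mul, Pi.add_apply, Pi.sub_apply] at this
  linarith

/-- In the region where `p_λ` is increasing, solutions starting at rest spread apart. -/
theorem IsC2On.spread {e s T : ℝ} {u₁ v₁ u₂ v₂ : ℝ → ℝ}
    (h₁ : DuffingOn e (3 * s ^ 2) u₁ v₁ 0 T) (h₂ : DuffingOn e (3 * s ^ 2) u₂ v₂ 0 T) (he : 0 < e)
    (hs : 0 < s) (hv₁ : v₁ 0 = 0) (hv₂ : v₂ 0 = 0) (hle : ∀ t ∈ Icc 0 T, u₂ t ≤ -s)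
    (hlt : u₁ 0 < u₂ 0) : ∀ t ∈ Icc 0 T, u₂ 0 - u₁ 0 ≤ u₂ t - u₁ t := by
  set d := u₂ 0 - u₁ 0 with hd
  have hd0 : 0 < d := sub_pos.2 hlt
  intro t ht
  refine ((h₂.sub h₁).escape_of_pos (c := d * (s * d) / e) (by positivity) (by simp [hv₁, hv₂])
    (fun r hr hur => ?_) t ht).1
  rw [← sub_div, add_sub_add_right_eq_sub]
  refine div_le_div_of_nonneg_right ?_ he.le
  have h1 := hle r hr
  have h2 : d ≤ u₂ r - u₁ r := hur
  generalize u₂ r = x at *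
  generalize u₁ r = y at *
  -- The gap gives `-y ≥ s + d`, which makes the factor of `x - y` in `p(x) - p(y)` strictly
  -- positive.
  have h3 : s * d ≤ x ^ 2 + x * y + y ^ 2 - 3 * s ^ 2 := by
    have a1 : s * s ≤ (-x) * (-x) := mul_le_mul (by linarith) (by linarith) hs.le (by linarith)
    have a2 : s * (s + d) ≤ (-x) * (-y) :=
      mul_le_mul (by linarith) (by linarith) (by linarith) (by linarith)
    have a3 : s * (s + d) ≤ (-y) * (-y) :=
      mul_le_mul (by linarith) (by linarith) (by linarith) (by linarith)
    nlinarith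
  calc d * (s * d) ≤ (x - y) * (x ^ 2 + x * y + y ^ 2 - 3 * s ^ 2) :=
        mul_le_mul h2 h3 (by positivity) (by linarith)
    _ = _ := by unfold cubicP; ring

namespace IsLeftRoot

variable {s α : ℝ}

theorem eventually_initial_not_lt (hα : IsLeftRoot s α) :
    ∀ᶠ e in 𝓝[>] 0, ∀ u₁ v₁ u₂ v₂, NeumannDuffing e (3 * s ^ 2) u₁ v₁ →
      NeumannDuffing e (3 * s ^ 2) u₂ v₂ → ¬ u₁ 0 < u₂ 0 := by
  obtain ⟨T, ⟨hT0, hTπ⟩, hT⟩ := hα.eventually_le_neg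
  have hcosT : Real.cos T < 1 := by
    simpa using Real.cos_lt_cos_of_nonneg_of_le_pi le_rfl (by linarith) hT0
  obtain ⟨η, hη, hQ⟩ := hα.exists_quarticP_lipschitz (by linarith : 0 < (1 - Real.cos T) / 2)
  filter_upwards [hT, hα.eventually_initial_lt hη, hα.eventually_deriv_pos,
    self_mem_nhdsWithin] with e hT hη hpos (he : 0 < e) u₁ v₁ u₂ v₂ h₁ h₂ hlt
  have hs := hα.pos
  have hp₁ := hpos _ _ h₁
  have hp₂ := hpos _ _ h₂
  have hq := hQ _ _ (hα.lt_initial he h₁) hlt.le (hη _ _ h₂)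
  have hTπ' : T ≤ Real.pi := by linarith
  have hspread := (h₁.sol.mono le_rfl hTπ').spread (h₂.sol.mono le_rfl hTπ') he hs h₁.left
    h₂.left (hT _ _ h₂ hp₂) hlt
  set d := u₂ 0 - u₁ 0 with hd
  have hd0 : 0 < d := sub_pos.2 hlt
  have hdT : 0 < d * (1 - Real.cos T) := mul_pos hd0 (by linarith)
  have hinit : ∀ y, d * (1 - Real.cos T) ≤
      duffingEnergy e (3 * s ^ 2) y u₂ v₂ T - duffingEnergy e (3 * s ^ 2) y u₁ v₁ T
        + d * (1 - Real.cos T) / 2 := by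
    intro y
    have h := (h₁.sol.mono le_rfl hTπ').energy_sub_ge (h₂.sol.mono le_rfl hTπ') (y := y) he le_rfl
      hT0.le hTπ' (fun t ht => hspread t (Ioo_subset_Icc_self ht))
    rw [Real.cos_zero] at h
    have h0 : duffingEnergy e (3 * s ^ 2) y u₂ v₂ 0 - duffingEnergy e (3 * s ^ 2) y u₁ v₁ 0
        = -(quarticP (3 * s ^ 2) (u₂ 0) + u₂ 0 - (quarticP (3 * s ^ 2) (u₁ 0) + u₁ 0)) := by
      simp only [duffingEnergy, h₁.left, h₂.left, Real.cos_zero]; ring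
    linarith
  -- At a first meeting point the energy difference is `e(v₂² - v₁²)/2`, positive since it was
  -- positive at `T`. With both speeds positive this contradicts `v₂ ≤ v₁` at a crossing; at π both
  -- speeds vanish.
  have hord : ∀ t ∈ Icc 0 Real.pi, 0 < u₂ t - u₁ t := by
    by_contra! hcon
    obtain ⟨τ, hτ, hτ0, hbefore⟩ := exists_first_zero (h₂.sol.sub h₁.sol).contU hd0 hcon
    have hTτ : T < τ := by
      by_contra! hle
      linarith [hspread τ ⟨hτ.1.le, hle⟩]
    have h := (h₁.sol.mono hT0.le hτ.2).energy_sub_ge (h₂.sol.mono hT0.le hτ.2) (y := u₂ τ) (d := 0)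
      he hT0.le hTτ.le hτ.2 (fun t ht => (hbefore t ⟨hT0.le.trans ht.1.le, ht.2⟩).le)
    have hE : duffingEnergy e (3 * s ^ 2) (u₂ τ) u₂ v₂ τ
        - duffingEnergy e (3 * s ^ 2) (u₂ τ) u₁ v₁ τ = e * (v₂ τ ^ 2 - v₁ τ ^ 2) / 2 := by
      have : u₁ τ = u₂ τ := by linarith
      simp only [duffingEnergy, this]; ring
    have hsq : 0 < e * (v₂ τ ^ 2 - v₁ τ ^ 2) := by
      have := hinit (u₂ τ)
      linarith
    have hsq' : v₁ τ ^ 2 < v₂ τ ^ 2 := by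
      have := (mul_pos_iff_of_pos_left he).1 hsq
      linarith
    rcases hτ.2.eq_or_lt with rfl | hτπ
    · simp [h₁.right, h₂.right] at hsq'
    · have hle := nonpos_of_hasDerivAt_of_left_nonneg hτ.1
        ((h₂.sol.sub h₁.sol).derivU τ ⟨hτ.1, hτπ⟩) hτ0
        (fun t ht => (hbefore t ⟨ht.1.le, ht.2⟩).le)
      have b1 := hp₁ τ ⟨hτ.1, hτπ⟩
      have b2 := hp₂ τ ⟨hτ.1, hτπ⟩
      nlinarith
  -- Reflection exchanges the order and carries the estimates near 0 to `[π - T, π]`: the gap there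
  -- is at least its value at π, and the final energy difference is at most half the resulting gain.
  have hr₁ := h₁.reflect
  have hr₂ := h₂.reflect
  have hend := hord Real.pi (right_mem_Icc.2 Real.pi_pos.le)
  have hrlt : -u₂ (Real.pi - 0) < -u₁ (Real.pi - 0) := by simp only [sub_zero]; linarith
  have hrq := hQ _ _ (hα.lt_initial he hr₂) hrlt.le (hη _ _ hr₁)
  have hrspread := (hr₂.sol.mono le_rfl hTπ').spread (hr₁.sol.mono le_rfl hTπ') he hs hr₂.left
    hr₁.left (hT _ _ hr₁ (hpos _ _ hr₁)) hrlt
  simp only [sub_zero, quarticP_neg] at hrq hrspread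
  have hm := (h₁.sol.mono (x' := T) (y' := Real.pi - T) hT0.le (by linarith)).energy_sub_ge
    (h₂.sol.mono hT0.le (by linarith)) (y := 0) (d := 0) he hT0.le (by linarith) (by linarith)
    (fun t ht => (hord t ⟨by linarith [ht.1], by linarith [ht.2]⟩).le)
  have hl := (h₁.sol.mono (x' := Real.pi - T) (y' := Real.pi) (by linarith) le_rfl).energy_sub_ge
    (h₂.sol.mono (by linarith) le_rfl) (y := 0) (d := u₂ Real.pi - u₁ Real.pi) he (by linarith)
    (by linarith) le_rfl (fun t ht => by
      have := hrspread (Real.pi - t) ⟨by linarith [ht.2], by linarith [ht.1]⟩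
      rw [sub_sub_cancel] at this
      linarith)
  have hE : duffingEnergy e (3 * s ^ 2) 0 u₂ v₂ Real.pi
      - duffingEnergy e (3 * s ^ 2) 0 u₁ v₁ Real.pi
      = quarticP (3 * s ^ 2) (u₁ Real.pi) + -u₁ Real.pi
        - (quarticP (3 * s ^ 2) (u₂ Real.pi) + -u₂ Real.pi) := by
    simp only [duffingEnergy, h₁.right, h₂.right, Real.cos_pi]; ring
  rw [Real.cos_pi_sub, Real.cos_pi] at hl
  have hi := hinit 0
  have hend' : 0 < (u₂ Real.pi - u₁ Real.pi) * (1 - Real.cos T) :=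
    mul_pos hend (by linarith)
  linarith

/-- For small `ε` all Neumann solutions have the same initial value. -/
theorem eventually_initial_eq (hα : IsLeftRoot s α) :
    ∀ᶠ e in 𝓝[>] 0, ∀ u₁ v₁ u₂ v₂, NeumannDuffing e (3 * s ^ 2) u₁ v₁ →
      NeumannDuffing e (3 * s ^ 2) u₂ v₂ → u₁ 0 = u₂ 0 := by
  filter_upwards [hα.eventually_initial_not_lt] with e h u₁ v₁ u₂ v₂ h₁ h₂
  exact le_antisymm (not_lt.1 (h _ _ _ _ h₂ h₁)) (not_lt.1 (h _ _ _ _ h₁ h₂))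

end IsLeftRoot

/-! ### Uniqueness for nonpositive λ -/

/-- For `λ ≤ 0` all Neumann solutions have the same initial value, whatever `ε`. -/
theorem NeumannDuffing.initial_eq_of_nonpos {e lam : ℝ} {u₁ v₁ u₂ v₂ : ℝ → ℝ}
    (h₁ : NeumannDuffing e lam u₁ v₁) (h₂ : NeumannDuffing e lam u₂ v₂) (he : 0 < e)
    (hlam : lam ≤ 0) : u₁ 0 = u₂ 0 := by
  have key : ∀ {u₁ v₁ u₂ v₂ : ℝ → ℝ}, NeumannDuffing e lam u₁ v₁ → NeumannDuffing e lam u₂ v₂ →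
      ¬ u₁ 0 < u₂ 0 := by
    intro u₁ v₁ u₂ v₂ h₁ h₂ hlt
    set d := u₂ 0 - u₁ 0 with hd
    have hd0 : 0 < d := sub_pos.2 hlt
    have := ((h₂.sol.sub h₁.sol).escape_of_pos (c := d * (d ^ 2 / 4) / e) (by positivity)
      (by simp [h₁.left, h₂.left]) (fun r hr hur => by
        rw [← sub_div, add_sub_add_right_eq_sub]
        refine div_le_div_of_nonneg_right ?_ he.le
        have h2 : d ≤ u₂ r - u₁ r := hur
        generalize u₂ r = x at *
        generalize u₁ r = y at *
        -- From `x² + xy + y² = (3(x + y)² + (x - y)²)/4`.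
        have h3 : d ^ 2 / 4 ≤ x ^ 2 + x * y + y ^ 2 - lam := by
          nlinarith [sq_nonneg (x + y), mul_le_mul h2 h2 hd0.le (hd0.le.trans h2)]
        calc d * (d ^ 2 / 4) ≤ (x - y) * (x ^ 2 + x * y + y ^ 2 - lam) :=
              mul_le_mul h2 h3 (by positivity) (by linarith)
          _ = _ := by unfold cubicP; ring) Real.pi (right_mem_Icc.2 Real.pi_pos.le)).2.1
    rw [h₁.right, h₂.right, sub_self] at this
    have : 0 < d * (d ^ 2 / 4) / e * (Real.pi - 0) := by
      have := Real.pi_pos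
      rw [sub_zero]; positivity
    linarith
  exact le_antisymm (not_lt.1 (key h₂ h₁)) (not_lt.1 (key h₁ h₂))

/-! ### Global solutions for bounded Lipschitz forces -/

/-- `u` is a solution on the whole line of `u'' = G(t, u)`, with derivative `v`. -/
structure GlobalSolution (G : ℝ → ℝ → ℝ) (u v : ℝ → ℝ) : Prop where
  derivU : ∀ t, HasDerivAt u (v t) t
  derivV : ∀ t, HasDerivAt v (G t (u t)) t

theorem lipschitzWith_clamp (lo hi : ℝ) : LipschitzWith 1 fun x : ℝ => max lo (min hi x) :=
  (LipschitzWith.id.const_min hi).const_max lo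

theorem lipschitzWith_firstOrder {G : ℝ → ℝ → ℝ} {K : NNReal} (hG : ∀ t, LipschitzWith K (G t))
    {φ : ℝ → ℝ} (hφ : LipschitzWith 1 φ) (t : ℝ) :
    LipschitzWith (max 1 K) fun p : ℝ × ℝ => (φ p.2, G t p.1) := by
  have h := (hφ.comp LipschitzWith.prod_snd).prodMk ((hG t).comp LipschitzWith.prod_fst)
  simpa using h

/-- Picard–Lindelöf on an interval of prescribed length needs a bounded field, so the velocity
component is clamped too. The bound `C` on the force keeps the true velocity within `C * R`, so this
clamp is never active. -/
theorem exists_solution_on_Icc {G : ℝ → ℝ → ℝ} {K : NNReal} {C : ℝ}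
    (hG : ∀ t, LipschitzWith K (G t)) (hC : ∀ t x, |G t x| ≤ C) (hc : ∀ x, Continuous (G · x))
    (a : ℝ) {R : ℝ} (hR : 0 ≤ R) :
    ∃ α : ℝ → ℝ × ℝ, α 0 = (a, 0) ∧
      ∀ t ∈ Icc (-R) R, HasDerivWithinAt α ((α t).2, G t (α t).1) (Icc (-R) R) t := by
  have hC0 : 0 ≤ C := (abs_nonneg _).trans (hC 0 0)
  set φ : ℝ → ℝ := fun x => max (-(C * R)) (min (C * R) x) with hφ
  have hCR : 0 ≤ C * R := by positivity
  have hφb : ∀ x, |φ x| ≤ C * R := fun x => abs_le.2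
    ⟨le_max_left _ _, max_le (by linarith) (min_le_left _ _)⟩
  set L : NNReal := (max (C * R) C).toNNReal
  have hPL : IsPicardLindelof (fun t (p : ℝ × ℝ) => (φ p.2, G t p.1))
      (⟨0, by linarith, hR⟩ : Icc (-R) R) (a, 0) (L * R.toNNReal) 0 L (max 1 K) := by
    refine ⟨fun t _ => (lipschitzWith_firstOrder hG (lipschitzWith_clamp _ _) t).lipschitzOnWith,
      fun p _ => (continuous_const.prodMk (hc p.1)).continuousOn, fun t _ p _ => ?_, ?_⟩
    · rw [Prod.norm_def]
      exact max_le ((hφb _).trans ((le_max_left _ _).trans (Real.le_coe_toNNReal _)))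
        ((hC _ _).trans ((le_max_right _ _).trans (Real.le_coe_toNNReal _)))
    · simp [Real.coe_toNNReal R hR]
  obtain ⟨α, h0, hα⟩ := hPL.exists_eq_forall_mem_Icc_hasDerivWithinAt₀
  refine ⟨α, h0, fun t ht => ?_⟩
  have hb := Convex.norm_image_sub_le_of_norm_hasDerivWithin_le (s := Icc (-R) R) (C := C)
    (f := fun t => (α t).2) (f' := fun t => G t (α t).1) (fun t ht => (hα t ht).snd)
    (fun t _ => hC _ _) (convex_Icc _ _) (⟨by linarith, hR⟩ : (0 : ℝ) ∈ Icc (-R) R) ht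
  have h0' : (α 0).2 = 0 := by rw [show α 0 = (a, 0) from h0]
  rw [h0', sub_zero, sub_zero, Real.norm_eq_abs, Real.norm_eq_abs] at hb
  have hb' : |(α t).2| ≤ C * R := hb.trans (mul_le_mul_of_nonneg_left (abs_le.2 ht) hC0)
  have hid : φ (α t).2 = (α t).2 := by
    rw [hφ]
    simp only
    rw [min_eq_right (abs_le.1 hb').2, max_eq_right (abs_le.1 hb').1]
  have := hα t ht
  simp only [hid] at this
  exact this

theorem exists_globalSolution {G : ℝ → ℝ → ℝ} {K : NNReal} {C : ℝ}
    (hG : ∀ t, LipschitzWith K (G t)) (hC : ∀ t x, |G t x| ≤ C) (hc : ∀ x, Continuous (G · x))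
    (a : ℝ) : ∃ u v, GlobalSolution G u v ∧ u 0 = a ∧ v 0 = 0 := by
  have hex : ∀ n : ℕ, ∃ α : ℝ → ℝ × ℝ, α 0 = (a, 0) ∧
      ∀ t ∈ Ioo (-(n + 1) : ℝ) (n + 1), HasDerivAt α ((α t).2, G t (α t).1) t := by
    intro n
    obtain ⟨α, h0, hα⟩ := exists_solution_on_Icc hG hC hc a (by positivity : (0 : ℝ) ≤ n + 1)
    exact ⟨α, h0, fun t ht =>
      (hα t (Ioo_subset_Icc_self ht)).hasDerivAt (Icc_mem_nhds ht.1 ht.2)⟩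
  choose α h0 hα using hex
  have hagree : ∀ n m : ℕ, ∀ t : ℝ, |t| < n + 1 → |t| < m + 1 → α n t = α m t := by
    intro n m t hn hm
    set R := min ((n : ℝ) + 1) (m + 1)
    have hR : 0 < R := lt_min (by positivity) (by positivity)
    refine ODE_solution_unique_of_mem_Ioo (v := fun t (p : ℝ × ℝ) => (p.2, G t p.1))
      (s := fun _ => univ) (K := max 1 K) (a := -R) (b := R) (t₀ := 0)
      (fun t _ => (lipschitzWith_firstOrder hG LipschitzWith.id t).lipschitzOnWith)
      ⟨by linarith, hR⟩ (fun r hr => ⟨hα n r ?_, trivial⟩) (fun r hr => ⟨hα m r ?_, trivial⟩)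
      ((h0 n).trans (h0 m).symm) (abs_lt.1 (lt_min hn hm))
    · exact abs_lt.1 ((abs_lt.2 hr).trans_le (min_le_left _ _))
    · exact abs_lt.1 ((abs_lt.2 hr).trans_le (min_le_right _ _))
  -- The solution of index `⌈|t|⌉₊` lives on an interval one unit longer, which leaves room for a
  -- neighbourhood of `t`.
  set β : ℝ → ℝ × ℝ := fun t => α ⌈|t|⌉₊ t with hβ
  have hβd : ∀ t, HasDerivAt β ((β t).2, G t (β t).1) t := by
    intro t
    have hN : |t| < (⌈|t|⌉₊ : ℝ) + 1 := (Nat.le_ceil _).trans_lt (lt_add_one _)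
    refine (hα ⌈|t|⌉₊ t (abs_lt.1 hN)).congr_of_eventuallyEq ?_
    filter_upwards [continuous_abs.continuousAt.eventually (gt_mem_nhds hN)] with r hr
    exact hagree _ _ r ((Nat.le_ceil _).trans_lt (lt_add_one _)) hr
  have hβ0 : β 0 = (a, 0) := h0 _
  exact ⟨fun t => (β t).1, fun t => (β t).2, ⟨fun t => (hβd t).fst, fun t => (hβd t).snd⟩,
    by simp [hβ0], by simp [hβ0]⟩

namespace GlobalSolution

variable {G : ℝ → ℝ → ℝ} {K : NNReal} {u v u' v' : ℝ → ℝ}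

theorem hasDerivAt_prod (h : GlobalSolution G u v) (t : ℝ) :
    HasDerivAt (fun t => (u t, v t)) (v t, G t (u t)) t :=
  (h.derivU t).prodMk (h.derivV t)

theorem unique (hG : ∀ t, LipschitzWith K (G t)) (h : GlobalSolution G u v)
    (h' : GlobalSolution G u' v') {t₀ : ℝ} (hu : u t₀ = u' t₀) (hv : v t₀ = v' t₀) :
    u = u' ∧ v = v' := by
  have := ODE_solution_unique_univ (v := fun t (p : ℝ × ℝ) => (p.2, G t p.1))
    (s := fun _ => univ) (K := max 1 K) (t₀ := t₀)
    (fun t => (lipschitzWith_firstOrder hG LipschitzWith.id t).lipschitzOnWith)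
    (fun t => ⟨h.hasDerivAt_prod t, trivial⟩) (fun t => ⟨h'.hasDerivAt_prod t, trivial⟩)
    (by simp [hu, hv])
  exact ⟨funext fun t => congrArg Prod.fst (congrFun this t),
    funext fun t => congrArg Prod.snd (congrFun this t)⟩

theorem dist_le (hG : ∀ t, LipschitzWith K (G t)) (h : GlobalSolution G u v)
    (h' : GlobalSolution G u' v') (hv : v 0 = v' 0) {T : ℝ} :
    ∀ t ∈ Icc 0 T, |u t - u' t| ≤ |u 0 - u' 0| * Real.exp (max 1 K * T) ∧
      |v t - v' t| ≤ |u 0 - u' 0| * Real.exp (max 1 K * T) := by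
  intro t ht
  have hd := dist_le_of_trajectories_ODE (v := fun t (p : ℝ × ℝ) => (p.2, G t p.1)) (K := max 1 K)
    (a := 0) (b := T) (δ := |u 0 - u' 0|) (f := fun t => (u t, v t)) (g := fun t => (u' t, v' t))
    (fun t => lipschitzWith_firstOrder hG LipschitzWith.id t)
    (fun t _ => (h.hasDerivAt_prod t).continuousAt.continuousWithinAt)
    (fun t _ => (h.hasDerivAt_prod t).hasDerivWithinAt)
    (fun t _ => (h'.hasDerivAt_prod t).continuousAt.continuousWithinAt)
    (fun t _ => (h'.hasDerivAt_prod t).hasDerivWithinAt)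
    (by rw [Prod.dist_eq]; simp [hv, Real.dist_eq]) t ht
  have hexp : Real.exp (((max 1 K : NNReal) : ℝ) * (t - 0)) ≤ Real.exp (max 1 K * T) := by
    rw [sub_zero]
    push_cast
    exact Real.exp_le_exp.2 (mul_le_mul_of_nonneg_left ht.2 (by positivity))
  have hd' := hd.trans (mul_le_mul_of_nonneg_left hexp (abs_nonneg _))
  rw [Prod.dist_eq] at hd'
  exact ⟨(le_max_left _ _).trans hd', (le_max_right _ _).trans hd'⟩

theorem continuous_u (h : GlobalSolution G u v) : Continuous u :=
  continuous_iff_continuousAt.2 fun t => (h.derivU t).continuousAt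

theorem continuous_v (h : GlobalSolution G u v) : Continuous v :=
  continuous_iff_continuousAt.2 fun t => (h.derivV t).continuousAt

end GlobalSolution

/-! ### The flow of the clamped equation -/

/-- The force of the Duffing equation with `u` clamped to `[lo, hi]`. -/
noncomputable def clampedForce (e lam lo hi t x : ℝ) : ℝ :=
  (cubicP lam (max lo (min hi x)) + Real.cos t) / e

theorem continuous_clampedForce (e lam lo hi : ℝ) :
    Continuous fun p : ℝ × ℝ => clampedForce e lam lo hi p.1 p.2 := by
  unfold clampedForce cubicP; fun_prop

theorem abs_clamp_le {lo hi M : ℝ} (hlo : |lo| ≤ M) (hhi : |hi| ≤ M) (x : ℝ) :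
    |max lo (min hi x)| ≤ M := by
  rw [abs_le] at *
  exact ⟨le_max_of_le_left hlo.1, max_le hlo.2 ((min_le_left _ _).trans hhi.2)⟩

theorem exists_lipschitz_clampedForce (e lam lo hi : ℝ) :
    ∃ K : NNReal, ∀ t, LipschitzWith K (clampedForce e lam lo hi t) := by
  set M := max |lo| |hi|
  have hM : 0 ≤ M := (abs_nonneg _).trans (le_max_left _ _)
  refine ⟨((3 * M ^ 2 + |lam|) / |e|).toNNReal, fun t => LipschitzWith.of_dist_le_mul
    fun x y => ?_⟩
  have hx := abs_clamp_le (le_max_left |lo| |hi|) (le_max_right _ _) x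
  have hy := abs_clamp_le (le_max_left |lo| |hi|) (le_max_right _ _) y
  have hxy := (lipschitzWith_clamp lo hi).dist_le_mul x y
  rw [Real.coe_toNNReal _ (by positivity)]
  simp only [Real.dist_eq, NNReal.coe_one, one_mul, clampedForce] at hxy ⊢
  rw [← sub_div, abs_div, add_sub_add_right_eq_sub, div_mul_eq_mul_div]
  refine div_le_div_of_nonneg_right ?_ (abs_nonneg e)
  generalize max lo (min hi x) = p at *
  generalize max lo (min hi y) = q at *
  have h1 : cubicP lam p - cubicP lam q = (p ^ 2 + p * q + q ^ 2 - lam) * (p - q) := by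
    unfold cubicP; ring
  rw [h1, abs_mul]
  refine mul_le_mul ?_ hxy (abs_nonneg _) (by positivity)
  rw [abs_le] at hx hy
  have b1 : |p ^ 2 + p * q + q ^ 2| ≤ 3 * M ^ 2 := by
    rw [abs_le]; constructor <;> nlinarith
  exact (abs_sub _ _).trans (add_le_add b1 le_rfl)

theorem exists_clampedFlow (e lam lo hi : ℝ) :
    ∃ U V : ℝ → ℝ → ℝ, ∀ a, GlobalSolution (clampedForce e lam lo hi) (U a) (V a) ∧
      U a 0 = a ∧ V a 0 = 0 := by
  obtain ⟨K, hK⟩ := exists_lipschitz_clampedForce e lam lo hi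
  set M := max |lo| |hi|
  have hM : 0 ≤ M := (abs_nonneg _).trans (le_max_left _ _)
  obtain ⟨B, hB⟩ := (isCompact_Icc (a := -M) (b := M)).exists_bound_of_continuousOn
    (continuous_cubicP lam).continuousOn
  have hC : ∀ t x, |clampedForce e lam lo hi t x| ≤ (B + 1) / |e| := by
    intro t x
    rw [clampedForce, abs_div]
    refine div_le_div_of_nonneg_right ((abs_add_le _ _).trans (add_le_add ?_
      (Real.abs_cos_le_one t))) (abs_nonneg e)
    exact hB _ (abs_le.1 (abs_clamp_le (le_max_left _ _) (le_max_right _ _) x))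
  choose U V h using exists_globalSolution hK hC (fun x =>
    (continuous_clampedForce e lam lo hi).comp (continuous_id.prodMk continuous_const))
  exact ⟨U, V, h⟩

theorem GlobalSolution.isC2On {G : ℝ → ℝ → ℝ} {u v : ℝ → ℝ} (h : GlobalSolution G u v)
    (hG : Continuous fun p : ℝ × ℝ => G p.1 p.2) (x y : ℝ) :
    IsC2On u v (fun t => G t (u t)) x y :=
  ⟨h.continuous_u.continuousOn, h.continuous_v.continuousOn,
    (hG.comp (continuous_id.prodMk h.continuous_u)).continuousOn, fun t _ => h.derivU t,
    fun t _ => h.derivV t⟩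

theorem clampedForce_of_mem {e lam lo hi t x : ℝ} (hx : x ∈ Icc lo hi) :
    clampedForce e lam lo hi t x = (cubicP lam x + Real.cos t) / e := by
  rw [clampedForce, min_eq_right hx.2, max_eq_right hx.1]

theorem clampedForce_of_ge {e lam lo hi t x : ℝ} (h : lo ≤ hi) (hx : hi ≤ x) :
    clampedForce e lam lo hi t x = (cubicP lam hi + Real.cos t) / e := by
  rw [clampedForce, min_eq_left hx, max_eq_right h]

theorem clampedForce_of_le {e lam lo hi t x : ℝ} (h : lo ≤ hi) (hx : x ≤ lo) :
    clampedForce e lam lo hi t x = (cubicP lam lo + Real.cos t) / e := by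
  rw [clampedForce, min_eq_right (hx.trans h), max_eq_left hx]

/-- The flow, with time clamped to `[0, π]`, is continuous in initial value and time. -/
theorem continuous_clampedFlow {e lam lo hi : ℝ} {U V : ℝ → ℝ → ℝ}
    (hUV : ∀ a, GlobalSolution (clampedForce e lam lo hi) (U a) (V a) ∧ U a 0 = a ∧ V a 0 = 0) :
    Continuous (fun p : ℝ × ℝ => U p.1 (max 0 (min Real.pi p.2))) ∧
      Continuous (fun p : ℝ × ℝ => V p.1 (max 0 (min Real.pi p.2))) := by
  obtain ⟨K, hK⟩ := exists_lipschitz_clampedForce e lam lo hi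
  have hτ : Continuous fun t : ℝ => max 0 (min Real.pi t) := by fun_prop
  have hd : ∀ a b t, |U a (max 0 (min Real.pi t)) - U b (max 0 (min Real.pi t))|
        ≤ |a - b| * Real.exp (max 1 K * Real.pi) ∧
      |V a (max 0 (min Real.pi t)) - V b (max 0 (min Real.pi t))|
        ≤ |a - b| * Real.exp (max 1 K * Real.pi) := by
    intro a b t
    have := (hUV a).1.dist_le hK (hUV b).1 ((hUV a).2.2.trans (hUV b).2.2.symm)
      (max 0 (min Real.pi t)) ⟨le_max_left _ _, max_le Real.pi_pos.le (min_le_left _ _)⟩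
    rwa [(hUV a).2.1, (hUV b).2.1] at this
  constructor
  · refine continuous_prod_of_continuous_lipschitzWith _ (Real.exp (max 1 K * Real.pi)).toNNReal
      (fun a => (hUV a).1.continuous_u.comp hτ) fun t => LipschitzWith.of_dist_le_mul fun a b => ?_
    rw [Real.coe_toNNReal _ (Real.exp_pos _).le, Real.dist_eq, Real.dist_eq, mul_comm]
    exact (hd a b t).1
  · refine continuous_prod_of_continuous_lipschitzWith _ (Real.exp (max 1 K * Real.pi)).toNNReal
      (fun a => (hUV a).1.continuous_v.comp hτ) fun t => LipschitzWith.of_dist_le_mul fun a b => ?_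
    rw [Real.coe_toNNReal _ (Real.exp_pos _).le, Real.dist_eq, Real.dist_eq, mul_comm]
    exact (hd a b t).2

/-! ### Supercritical case: a negative Neumann solution -/

/-- If the local maximum `p_λ(-s) = 2 s³` of `p_λ`, `λ = 3 s²`, exceeds `1`, there is a negative
Neumann solution. -/
theorem exists_negative_solution {e s : ℝ} (he : 0 < e) (hs : 0 < s) (hs3 : 1 < 2 * s ^ 3) :
    ∃ u v : ℝ → ℝ, (∀ t, HasDerivAt u (v t) t) ∧
      (∀ t ∈ Icc 0 Real.pi, HasDerivAt v ((cubicP (3 * s ^ 2) (u t) + Real.cos t) / e) t) ∧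
      v 0 = 0 ∧ v Real.pi = 0 ∧ ∀ t ∈ Icc 0 Real.pi, u t < 0 := by
  set lam := 3 * s ^ 2 with hlam
  set lo := -(1 + 2 * s) with hlo
  have hle : lo ≤ -s := by linarith
  have hπ := Real.pi_pos.le
  have hphi : cubicP lam (-s) = 2 * s ^ 3 := by unfold cubicP; ring
  have hplo : cubicP lam lo < -1 := by
    have : cubicP lam lo = -1 - (6 * s + 9 * s ^ 2 + 2 * s ^ 3) := by
      rw [hlam, hlo]; unfold cubicP; ring
    have : 0 < 6 * s + 9 * s ^ 2 + 2 * s ^ 3 := by positivity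
    linarith
  have hhigh : ∀ t x, -s ≤ x → (2 * s ^ 3 - 1) / e ≤ clampedForce e lam lo (-s) t x := by
    intro t x hx
    rw [clampedForce_of_ge hle hx, hphi]
    exact div_le_div_of_nonneg_right (by linarith [Real.neg_one_le_cos t]) he.le
  have hlow : ∀ t x, x ≤ lo → (-1 - cubicP lam lo) / e ≤ -clampedForce e lam lo (-s) t x := by
    intro t x hx
    rw [clampedForce_of_le hle hx, ← neg_div]
    exact div_le_div_of_nonneg_right (by linarith [Real.cos_le_one t]) he.le
  have hc1 : 0 < (2 * s ^ 3 - 1) / e := div_pos (by linarith) he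
  have hc2 : 0 < (-1 - cubicP lam lo) / e := div_pos (by linarith) he
  obtain ⟨U, V, hUV⟩ := exists_clampedFlow e lam lo (-s)
  have hC2 : ∀ a x y, IsC2On (U a) (V a) (fun t => clampedForce e lam lo (-s) t (U a t)) x y :=
    fun a => (hUV a).1.isC2On (continuous_clampedForce _ _ _ _)
  have hcont : Continuous fun a => V a Real.pi := by
    have := (continuous_clampedFlow hUV).2.comp
      (continuous_id.prodMk (continuous_const (y := Real.pi)))
    simpa [Function.comp_def, hπ] using this
  have hVlo : V lo Real.pi ≤ 0 := by
    have := ((hC2 lo 0 Real.pi).neg.escape_of_pos hc2 (by simp [(hUV lo).2.2])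
      (fun t _ hut => hlow t _ (by linarith [(hUV lo).2.1])) Real.pi (right_mem_Icc.2 hπ)).2.1
    nlinarith
  have hVhi : 0 ≤ V (-s) Real.pi := by
    have := ((hC2 (-s) 0 Real.pi).escape_of_pos hc1 (by simp [(hUV (-s)).2.2])
      (fun t _ hut => hhigh t _ (by linarith [(hUV (-s)).2.1])) Real.pi (right_mem_Icc.2 hπ)).2.1
    nlinarith
  obtain ⟨a, ha, hVa⟩ := intermediate_value_Icc hle hcont.continuousOn ⟨hVlo, hVhi⟩
  simp only at hVa
  obtain ⟨hsol, hu0, hv0⟩ := hUV a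
  -- A trajectory leaving the strip does so with outward speed; the clamped force outside points
  -- outward, so it could not be at rest at π. Hence the clamp is inactive.
  have hmem : ∀ t ∈ Icc 0 Real.pi, U a t ∈ Icc lo (-s) := by
    intro t ht
    constructor
    · by_contra! hlt
      obtain ⟨ξ, hξ, hξu, hξv⟩ := (hC2 a 0 Real.pi).neg.exists_gt_of_crossing (B := -lo) ht
        (by linarith [ha.1]) (by linarith)
      have := ((hC2 a ξ Real.pi).neg.escape_of_nonneg hξv
        (fun r _ hr => hc2.le.trans (hlow r _ (by linarith))) Real.pi
        (right_mem_Icc.2 (hξ.2.le.trans ht.2))).2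
      linarith
    · by_contra! hlt
      obtain ⟨ξ, hξ, hξu, hξv⟩ := (hC2 a 0 Real.pi).exists_gt_of_crossing (B := -s) ht
        (by linarith [ha.2]) (by linarith)
      have := ((hC2 a ξ Real.pi).escape_of_nonneg hξv
        (fun r _ hr => hc1.le.trans (hhigh r _ (by linarith))) Real.pi
        (right_mem_Icc.2 (hξ.2.le.trans ht.2))).2
      linarith
  refine ⟨U a, V a, hsol.derivU, fun t ht => ?_, hv0, hVa, fun t ht => by linarith [(hmem t ht).2]⟩
  rw [← clampedForce_of_mem (hmem t ht)]
  exact hsol.derivV t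

/-! ### Existence of the symmetric periodic solution -/

/-- `v ≥ 0` on `[0, t₁]` already implies that `u` is pushed upwards at time `0` and that `v > 0` on
`(0, t₁]`, except possibly at `t₁ = π/2`. -/
theorem IsC2On.pos_of_nonneg {e lam t₁ : ℝ} {u v : ℝ → ℝ} (h : DuffingOn e lam u v 0 t₁)
    (he : 0 < e) (ht₁ : 0 < t₁) (hπ : t₁ ≤ Real.pi) (hv0 : v 0 = 0) (hv : ∀ t ∈ Icc 0 t₁, 0 ≤ v t) :
    0 < cubicP lam (u 0) + 1 ∧ ∀ t ∈ Ioo 0 t₁, 0 < v t := by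
  constructor
  · by_contra! hle
    obtain ⟨z, hz, hz'⟩ := h.exists_neg_right he le_rfl ht₁ hπ hv0 (by rwa [Real.cos_zero])
    exact absurd (hz' z (right_mem_Ioc.2 hz.1)) (not_lt.2 (hv z ⟨hz.1.le, hz.2⟩))
  · intro t ht
    refine (hv t (Ioo_subset_Icc_self ht)).lt_of_ne' fun h0 => ?_
    have hw := nonpos_of_hasDerivAt_of_left_nonneg ht.1 (h.derivV t ht) h0
      (fun r hr => hv r ⟨hr.1.le, hr.2.le.trans ht.2.le⟩)
    have hw' : cubicP lam (u t) + Real.cos t ≤ 0 := by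
      by_contra! hlt
      exact absurd hw (not_le.2 (div_pos hlt he))
    obtain ⟨z, hz, hz'⟩ := (h.mono ht.1.le le_rfl).exists_neg_right he ht.1.le ht.2 hπ h0 hw'
    exact absurd (hz' z (right_mem_Ioc.2 hz.1))
      (not_lt.2 (hv z ⟨ht.1.le.trans hz.1.le, hz.2⟩))

/-- Shooting: a solution of the clamped equation that increases on `(0, π/2)` from rest to `0`. -/
theorem exists_increasing_to_zero {e lam M : ℝ} (he : 0 < e) (hM : 0 < M)
    (hp : cubicP lam (-M) + 1 ≤ 0) :
    ∃ u v, GlobalSolution (clampedForce e lam (-M) M) u v ∧ v 0 = 0 ∧ -M ≤ u 0 ∧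
      u (Real.pi / 2) = 0 ∧ ∀ t ∈ Ioo 0 (Real.pi / 2), 0 < v t := by
  have hπ := Real.pi_pos
  obtain ⟨U, V, hUV⟩ := exists_clampedFlow e lam (-M) M
  obtain ⟨hU, hV⟩ := continuous_clampedFlow hUV
  have hτ : ∀ t ∈ Icc 0 Real.pi, max 0 (min Real.pi t) = t := fun t ht => by
    rw [min_eq_right ht.2, max_eq_right ht.1]
  have hG := continuous_clampedForce e lam (-M) M
  have hC2 : ∀ a x y, IsC2On (U a) (V a) (fun t => clampedForce e lam (-M) M t (U a t)) x y :=
    fun a => (hUV a).1.isC2On hG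
  -- Pairs (initial value, hitting time of 0) of nondecreasing trajectories. Rescaling time by `r ∈
  -- [0, 1]` expresses monotonicity on `[0, p.2]` by closed conditions with a fixed index set.
  set S : Set (ℝ × ℝ) := {p | p ∈ Icc (-M) 0 ×ˢ Icc 0 (Real.pi / 2) ∧
    (∀ r ∈ Icc (0 : ℝ) 1, 0 ≤ V p.1 (max 0 (min Real.pi (r * p.2)))) ∧
    U p.1 (max 0 (min Real.pi p.2)) = 0} with hS
  have hScl : IsClosed S := by
    have h1 : IsClosed {p : ℝ × ℝ | ∀ r ∈ Icc (0 : ℝ) 1,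
        0 ≤ V p.1 (max 0 (min Real.pi (r * p.2)))} := by
      simp only [ofPred_forall]
      exact isClosed_biInter fun r _ => isClosed_le continuous_const
        (hV.comp (continuous_fst.prodMk (continuous_snd.const_mul r)))
    exact (isClosed_Icc.prod isClosed_Icc).inter (h1.inter (isClosed_eq hU continuous_const))
  have hSc : IsCompact S := (isCompact_Icc.prod isCompact_Icc).of_isClosed_subset hScl
    fun p hp => hp.1
  have hmemS : ∀ a ∈ Icc (-M) 0, ∀ t₁ ∈ Icc 0 (Real.pi / 2), (∀ t ∈ Icc 0 t₁, 0 ≤ V a t) →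
      U a t₁ = 0 → (a, t₁) ∈ S := by
    intro a ha t₁ ht₁ hv hu
    refine ⟨⟨ha, ht₁⟩, fun r hr => ?_, ?_⟩
    · have h1 : r * t₁ ∈ Icc 0 t₁ :=
        ⟨mul_nonneg hr.1 ht₁.1, mul_le_of_le_one_left ht₁.1 hr.2⟩
      simp only
      rw [hτ _ ⟨h1.1, h1.2.trans (by linarith [ht₁.2])⟩]
      exact hv _ h1
    · simp only
      rw [hτ _ ⟨ht₁.1, by linarith [ht₁.2]⟩]
      exact hu
  -- Take the lowest initial value. If its hitting time were before π/2, a slightly lower start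
  -- would still rise to 0 in time.
  obtain ⟨⟨a, t₁⟩, ⟨⟨ha, ht₁⟩, hv, hu⟩, hmin⟩ := hSc.exists_isMinOn
    ⟨(0, 0), hmemS 0 ⟨by linarith, le_rfl⟩ 0 ⟨le_rfl, by linarith⟩ (fun t ht => by
      rw [le_antisymm ht.2 ht.1, (hUV 0).2.2]) (hUV 0).2.1⟩ continuous_fst.continuousOn
  simp only at ha ht₁ hv hu
  rw [hτ _ ⟨ht₁.1, by linarith [ht₁.2]⟩] at hu
  obtain ⟨hsol, hu0, hv0⟩ := hUV a
  replace hv : ∀ t ∈ Icc 0 t₁, 0 ≤ V a t := by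
    intro t ht
    rcases ht₁.1.eq_or_lt with h0 | h0
    · rw [le_antisymm (ht.2.trans h0.ge) ht.1, hv0]
    · have := hv (t / t₁) ⟨div_nonneg ht.1 h0.le, (div_le_one h0).2 ht.2⟩
      rwa [div_mul_cancel₀ _ h0.ne', hτ _ ⟨ht.1, by linarith [ht.2, ht₁.2]⟩] at this
  have hmem : ∀ t ∈ Icc 0 t₁, U a t ∈ Icc (-M) M := by
    intro t ht
    have hv' : ∀ r ∈ Ioo 0 t₁, 0 ≤ V a r := fun r hr => hv r (Ioo_subset_Icc_self hr)
    have h1 := (hC2 a 0 t₁).le_of_nonneg hv' le_rfl ht.1 ht.2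
    have h2 := (hC2 a 0 t₁).le_of_nonneg hv' ht.1 ht.2 le_rfl
    exact ⟨by linarith [ha.1], by linarith⟩
  have hD : DuffingOn e lam (U a) (V a) 0 t₁ := by
    have h := hC2 a 0 t₁
    refine ⟨h.contU, h.contV, h.contW.congr fun t ht => (clampedForce_of_mem (hmem t ht)).symm,
      h.derivU, fun t ht => ?_⟩
    rw [← clampedForce_of_mem (hmem t (Ioo_subset_Icc_self ht))]
    exact h.derivV t ht
  rcases ht₁.2.eq_or_lt with hend | hlt
  · subst hend
    exact ⟨U a, V a, hsol, hv0, by linarith [ha.1], hu,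
      (hD.pos_of_nonneg he (half_pos hπ) (by linarith) hv0 hv).2⟩
  exfalso
  have hw0 : 0 < cubicP lam a + 1 := by
    rcases ht₁.1.eq_or_lt with h0 | h0
    · rw [← h0, hu0] at hu
      simp [hu, cubicP]
    · have := (hD.pos_of_nonneg he h0 (by linarith) hv0 hv).1
      rwa [hu0] at this
  have haM : -M < a := lt_of_le_of_ne ha.1 (by rintro rfl; linarith)
  have hw0' : 0 < clampedForce e lam (-M) M 0 (U a 0) := by
    rw [clampedForce_of_mem (hmem 0 ⟨le_rfl, ht₁.1⟩), hu0, Real.cos_zero]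
    exact div_pos hw0 he
  -- an initial interval on which the solution is accelerated upwards
  obtain ⟨z, hz0, hz⟩ : ∃ z ∈ Ioc 0 (Real.pi / 2),
      ∀ t ∈ Icc 0 z, 0 < clampedForce e lam (-M) M t (U a t) := by
    have hev : ∀ᶠ t in 𝓝 0, 0 < clampedForce e lam (-M) M t (U a t) :=
      (hG.comp (continuous_id.prodMk hsol.continuous_u)).continuousAt.eventually (lt_mem_nhds hw0')
    obtain ⟨δ, hδ, h⟩ := mem_nhdsGE_iff_exists_Icc_subset.1
      (hev.filter_mono nhdsWithin_le_nhds)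
    exact ⟨min δ (Real.pi / 2), ⟨lt_min hδ (half_pos hπ), min_le_right _ _⟩,
      fun t ht => h ⟨ht.1, ht.2.trans (min_le_left _ _)⟩⟩
  have hacc : ∀ b, (∀ t ∈ Icc 0 z, 0 < clampedForce e lam (-M) M t (U b t)) →
      ∀ t ∈ Ioc 0 z, 0 < V b t := by
    intro b hb t ht
    have := mul_sub_lt_of_lt_hasDerivAt (c := 0) ht.1 (hC2 b 0 t).contV (hC2 b 0 t).derivV
      (fun r hr => hb r ⟨hr.1.le, hr.2.le.trans ht.2⟩)
    rw [(hUV b).2.2] at this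
    linarith
  obtain ⟨t₂, ht₂, hvt₂⟩ : ∃ t₂ ∈ Ioc t₁ (Real.pi / 2), ∀ t ∈ Ioc 0 t₂, 0 < V a t := by
    rcases lt_or_ge t₁ z with hlt' | hge
    · exact ⟨z, ⟨hlt', hz0.2⟩, hacc a hz⟩
    have h0 : 0 < t₁ := hz0.1.trans_le hge
    have hpos := (hD.pos_of_nonneg he h0 (by linarith) hv0 hv).2
    -- At a hitting time before π/2 the force is `cos t₁ > 0`, which excludes arriving at rest.
    have hvt₁ : 0 < V a t₁ := by
      refine (hv t₁ (right_mem_Icc.2 h0.le)).lt_of_ne' fun h => ?_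
      have := nonpos_of_hasDerivAt_of_left_nonneg h0 (hsol.derivV t₁) h fun r hr => (hpos r hr).le
      rw [clampedForce_of_mem (hmem t₁ (right_mem_Icc.2 h0.le)), hu] at this
      have hcos := Real.cos_pos_of_mem_Ioo ⟨by linarith, hlt⟩
      have : 0 < (cubicP lam 0 + Real.cos t₁) / e := div_pos (by simpa [cubicP] using hcos) he
      linarith
    obtain ⟨δ, hδ, h⟩ := mem_nhdsGE_iff_exists_Icc_subset.1
      ((hsol.continuous_v.continuousAt.eventually (lt_mem_nhds hvt₁)).filter_mono
        nhdsWithin_le_nhds)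
    refine ⟨min δ (Real.pi / 2), ⟨lt_min hδ hlt, min_le_right _ _⟩, fun t ht => ?_⟩
    rcases lt_or_ge t t₁ with htt | htt
    · exact hpos t ⟨ht.1, htt⟩
    · exact h ⟨htt, ht.2.trans (min_le_left _ _)⟩
  have ht₂0 : 0 < t₂ := ht₁.1.trans_lt ht₂.1
  have ht₂π : t₂ ≤ Real.pi := by linarith [ht₂.2]
  have hut₂ : 0 < U a t₂ := by
    have := (hC2 a 0 t₂).lt_of_pos (fun r hr => hvt₂ r ⟨hr.1, hr.2.le⟩) ht₁.1 ht₂.1 le_rfl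
    linarith
  -- these properties persist for slightly smaller initial values
  have hev₁ : ∀ᶠ b in 𝓝 a, ∀ t ∈ Icc 0 z,
      0 < clampedForce e lam (-M) M t (U b (max 0 (min Real.pi t))) := by
    refine isCompact_Icc.eventually_forall_of_forall_eventually fun t ht => ?_
    refine (hG.comp (continuous_snd.prodMk hU)).continuousAt.eventually (lt_mem_nhds ?_)
    simp only [Function.comp]
    rw [hτ t ⟨ht.1, by linarith [ht.2, hz0.2]⟩]
    exact hz t ht
  have hev₂ : ∀ᶠ b in 𝓝 a, ∀ t ∈ Icc z t₂, 0 < V b (max 0 (min Real.pi t)) := by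
    refine isCompact_Icc.eventually_forall_of_forall_eventually fun t ht => ?_
    refine hV.continuousAt.eventually (lt_mem_nhds ?_)
    simp only
    rw [hτ t ⟨hz0.1.le.trans ht.1, ht.2.trans ht₂π⟩]
    exact hvt₂ t ⟨hz0.1.trans_le ht.1, ht.2⟩
  have hev₃ : ∀ᶠ b in 𝓝 a, 0 < U b t₂ := by
    have hc : Continuous fun b => U b (max 0 (min Real.pi t₂)) :=
      hU.comp (continuous_id.prodMk continuous_const)
    rw [hτ t₂ ⟨ht₂0.le, ht₂π⟩] at hc
    exact hc.continuousAt.eventually (lt_mem_nhds hut₂)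
  obtain ⟨b, ⟨⟨hb₁, hb₂⟩, hb₃⟩, hb⟩ := ((((hev₁.and hev₂).and hev₃).filter_mono
    nhdsWithin_le_nhds).and (Ioo_mem_nhdsLT haM)).exists
  have hvb : ∀ t ∈ Icc 0 t₂, 0 ≤ V b t := by
    intro t ht
    rcases ht.1.eq_or_lt with rfl | h0
    · exact (hUV b).2.2.ge
    rcases le_total t z with htz | htz
    · refine (hacc b (fun r hr => ?_) t ⟨h0, htz⟩).le
      have := hb₁ r hr
      rwa [hτ r ⟨hr.1, by linarith [hr.2, hz0.2]⟩] at this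
    · have := hb₂ t ⟨htz, ht.2⟩
      rw [hτ t ⟨ht.1, ht.2.trans ht₂π⟩] at this
      exact this.le
  obtain ⟨t₃, ht₃, hut₃⟩ := intermediate_value_Icc ht₂0.le (hC2 b 0 t₂).contU
    ⟨by rw [(hUV b).2.1]; linarith [hb.2, ha.2], hb₃.le⟩
  have := hmin (hmemS b ⟨hb.1.le, by linarith [hb.2, ha.2]⟩ t₃ ⟨ht₃.1, ht₃.2.trans ht₂.2⟩
    (fun t ht => hvb t ⟨ht.1, ht.2.trans ht₃.2⟩) hut₃)
  simp only [mem_ofPred_eq] at this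
  linarith [hb.2]

theorem clamp_neg {M : ℝ} (hM : 0 ≤ M) (x : ℝ) :
    max (-M) (min M (-x)) = -max (-M) (min M x) := by
  rcases le_total x (-M) with h | h
  · rw [min_eq_left (by linarith), max_eq_right (by linarith), min_eq_right (by linarith),
      max_eq_left h, neg_neg]
  · rcases le_total x M with h' | h'
    · rw [min_eq_right (by linarith), max_eq_right (by linarith), min_eq_right h', max_eq_right h]
    · rw [min_eq_right (by linarith), max_eq_left (by linarith), min_eq_left h',
        max_eq_right (by linarith)]

/-- The symmetric periodic solution `u_p` exists for all parameter values. -/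
theorem exists_symmetric_solution {e : ℝ} (lam : ℝ) (he : 0 < e) :
    ∃ u v : ℝ → ℝ, (∀ t, HasDerivAt u (v t) t) ∧
      (∀ t, HasDerivAt v ((cubicP lam (u t) + Real.cos t) / e) t) ∧
      Function.Periodic u (2 * Real.pi) ∧ v 0 = 0 ∧ v Real.pi = 0 ∧ u (Real.pi / 2) = 0 ∧
      ∀ t ∈ Ioo 0 (Real.pi / 2), 0 < v t := by
  have hπ := Real.pi_pos
  set M := |lam| + 2 with hMdef
  have hM : 0 < M := by positivity
  have hp : cubicP lam (-M) + 1 ≤ 0 := by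
    have h1 : 0 ≤ |lam| := abs_nonneg lam
    have h2 : lam ≤ |lam| := le_abs_self lam
    have h3 : 4 ≤ M ^ 2 - lam := by rw [hMdef]; nlinarith
    have h4 : cubicP lam (-M) = -(M * (M ^ 2 - lam)) := by unfold cubicP; ring
    have h5 : 2 * 4 ≤ M * (M ^ 2 - lam) := mul_le_mul (by linarith) h3 (by norm_num) hM.le
    linarith
  obtain ⟨u, v, hsol, hv0, hu0, huπ, hpos⟩ := exists_increasing_to_zero he hM hp
  obtain ⟨K, hK⟩ := exists_lipschitz_clampedForce e lam (-M) M
  -- By uniqueness of initial value problems, rest at 0 makes `u` even, and `u(π/2) = 0` makes it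
  -- odd about π/2. Together these give antiperiodicity under π, and the bound on `[0, π/2]` extends
  -- to the line, which removes the clamp.
  have heven : ∀ t, u (-t) = u t := by
    have h : GlobalSolution (clampedForce e lam (-M) M) (fun t => u (-t)) (fun t => -v (-t)) := by
      constructor <;> intro t
      · exact ((hsol.derivU (-t)).comp t (hasDerivAt_neg t)).congr_deriv (by ring)
      · refine ((hsol.derivV (-t)).comp t (hasDerivAt_neg t)).neg.congr_deriv ?_
        simp [clampedForce]
    exact fun t => congrFun (h.unique hK hsol (t₀ := 0) (by simp) (by simp [hv0])).1 t
  have hodd : (fun t => -u (Real.pi - t)) = u ∧ (fun t => v (Real.pi - t)) = v := by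
    have h : GlobalSolution (clampedForce e lam (-M) M) (fun t => -u (Real.pi - t))
        (fun t => v (Real.pi - t)) := by
      have hd : ∀ t : ℝ, HasDerivAt (fun t => Real.pi - t) (-1) t := fun t =>
        (hasDerivAt_id' t).const_sub _
      constructor <;> intro t
      · exact ((hsol.derivU (Real.pi - t)).comp t (hd t)).neg.congr_deriv (by ring)
      · refine ((hsol.derivV (Real.pi - t)).comp t (hd t)).congr_deriv ?_
        simp only [clampedForce, clamp_neg hM.le, cubicP_neg, Real.cos_pi_sub]
        ring
    have hhalf : Real.pi - Real.pi / 2 = Real.pi / 2 := by ring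
    exact h.unique hK hsol (t₀ := Real.pi / 2) (by simp only [hhalf, huπ, neg_zero])
      (by simp only [hhalf])
  have hodd' : ∀ t, u t = -u (Real.pi - t) := fun t => (congrFun hodd.1 t).symm
  have hanti : ∀ t, u (t + Real.pi) = -u t := by
    intro t
    rw [hodd' (t + Real.pi), show Real.pi - (t + Real.pi) = -t by ring, heven]
  have hper : Function.Periodic u (2 * Real.pi) := by
    intro t
    rw [show t + 2 * Real.pi = t + Real.pi + Real.pi by ring, hanti, hanti, neg_neg]
  have hb₁ : ∀ t ∈ Icc 0 (Real.pi / 2), |u t| ≤ M := by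
    intro t ht
    have h := hsol.isC2On (continuous_clampedForce e lam (-M) M) 0 (Real.pi / 2)
    have h1 := h.le_of_nonneg (fun r hr => (hpos r hr).le) le_rfl ht.1 ht.2
    have h2 := h.le_of_nonneg (fun r hr => (hpos r hr).le) ht.1 ht.2 le_rfl
    rw [abs_le]; constructor <;> linarith
  have hb₂ : ∀ t ∈ Icc 0 Real.pi, |u t| ≤ M := by
    intro t ht
    rcases le_total t (Real.pi / 2) with h | h
    · exact hb₁ t ⟨ht.1, h⟩
    · rw [hodd' t, abs_neg]
      exact hb₁ _ ⟨by linarith [ht.2], by linarith⟩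
  have hb : ∀ t, |u t| ≤ M := by
    intro t
    obtain ⟨r, hr, hrt⟩ := hper.exists_mem_Ico (by positivity) t (-Real.pi)
    rw [hrt]
    rcases le_total 0 r with h | h
    · exact hb₂ r ⟨h, by linarith [hr.2]⟩
    · rw [← heven]
      exact hb₂ (-r) ⟨by linarith, by linarith [hr.1]⟩
  refine ⟨u, v, hsol.derivU, fun t => ?_, hper, hv0, ?_, huπ, hpos⟩
  · rw [← clampedForce_of_mem (abs_le.1 (hb t))]
    exact hsol.derivV t
  · have := congrFun hodd.2 0
    simp only [sub_zero] at this
    rw [this, hv0]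

/-! ### Passage to one-sided derivatives on intervals -/

theorem isSolutionOn_of_hasDerivAt {ε lam : ℝ} {J : Set ℝ} {u v : ℝ → ℝ} (hε : 0 < ε)
    (hJ : UniqueDiffOn ℝ J) (hu : ∀ t ∈ J, HasDerivAt u (v t) t)
    (hv : ∀ t ∈ J, HasDerivAt v ((cubicP lam (u t) + Real.cos t) / ε ^ 2) t) :
    IsSolutionOn ε lam J u ∧ EqOn (derivWithin u J) v J := by
  have hEq : EqOn (derivWithin u J) v J := fun t ht =>
    (hu t ht).hasDerivWithinAt.derivWithin (hJ t ht)
  have hd : ∀ t ∈ J, HasDerivWithinAt (derivWithin u J)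
      ((cubicP lam (u t) + Real.cos t) / ε ^ 2) J t := fun t ht =>
    (hv t ht).hasDerivWithinAt.congr hEq (hEq ht)
  refine ⟨⟨fun t ht => (hu t ht).differentiableAt.differentiableWithinAt,
    fun t ht => (hd t ht).differentiableWithinAt, fun t ht => ?_⟩, hEq⟩
  rw [(hd t ht).derivWithin (hJ t ht)]
  field_simp

namespace IsSolutionOn

variable {ε lam : ℝ} {J : Set ℝ} {u w : ℝ → ℝ}

theorem hasDerivWithinAt_prod (h : IsSolutionOn ε lam J u) (hε : 0 < ε) {t : ℝ} (ht : t ∈ J) :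
    HasDerivWithinAt (fun t => (u t, derivWithin u J t))
      (derivWithin u J t, (cubicP lam (u t) + Real.cos t) / ε ^ 2) J t := by
  have h2 := (h.2.1 t ht).hasDerivWithinAt
  have h3 := h.2.2 t ht
  rw [mul_comm, ← eq_div_iff (by positivity)] at h3
  rw [h3] at h2
  exact (h.1 t ht).hasDerivWithinAt.prodMk h2

theorem duffingOn (h : IsSolutionOn ε lam J u) (hε : 0 < ε) {x y : ℝ} (hJ : Icc x y ⊆ J) :
    DuffingOn (ε ^ 2) lam u (derivWithin u J) x y := by
  have hu := h.1.continuousOn.mono hJ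
  have hmem : ∀ t ∈ Ioo x y, J ∈ 𝓝 t := fun t ht =>
    mem_of_superset (Icc_mem_nhds ht.1 ht.2) hJ
  have hd : ∀ t ∈ Ioo x y, _ := fun t ht =>
    (h.hasDerivWithinAt_prod hε (hJ (Ioo_subset_Icc_self ht))).hasDerivAt (hmem t ht)
  exact ⟨hu, h.2.1.continuousOn.mono hJ, (((continuous_cubicP lam).comp_continuousOn hu).add
    Real.continuous_cos.continuousOn).div_const _, fun t ht => (hd t ht).fst,
    fun t ht => (hd t ht).snd⟩

/-- Solutions with the same initial data at `0` coincide. -/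
theorem eqOn {J' : Set ℝ} (h : IsSolutionOn ε lam J u) (h' : IsSolutionOn ε lam J' w) (hε : 0 < ε)
    (hJ : J.OrdConnected) (h0 : 0 ∈ J) (hJJ' : J ⊆ J') (hu : u 0 = w 0)
    (hv : derivWithin u J 0 = derivWithin w J' 0) : EqOn u w J := by
  intro t ht
  -- The cubic is only locally Lipschitz. Between 0 and `t` both solutions are bounded, so they
  -- solve a common clamped equation, which is globally Lipschitz.
  have hcpt : ∀ x y, Icc x y ⊆ J → ∃ R, ∀ r ∈ Icc x y, |u r| ≤ R ∧ |w r| ≤ R := by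
    intro x y hxy
    obtain ⟨A, hA⟩ := isCompact_Icc.exists_bound_of_continuousOn (h.1.continuousOn.mono hxy)
    obtain ⟨B, hB⟩ := isCompact_Icc.exists_bound_of_continuousOn
      (h'.1.continuousOn.mono (hxy.trans hJJ'))
    exact ⟨max A B, fun r hr => ⟨(hA r hr).trans (le_max_left _ _),
      (hB r hr).trans (le_max_right _ _)⟩⟩
  have hstart : (u 0, derivWithin u J 0) = (w 0, derivWithin w J' 0) := by rw [hu, hv]
  rcases le_total 0 t with h0t | ht0
  · have hsub : Icc 0 t ⊆ J := hJ.out h0 ht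
    obtain ⟨R, hR⟩ := hcpt 0 t hsub
    obtain ⟨K, hK⟩ := exists_lipschitz_clampedForce (ε ^ 2) lam (-R) R
    have := ODE_solution_unique (v := fun t (p : ℝ × ℝ) =>
        (p.2, clampedForce (ε ^ 2) lam (-R) R t p.1))
      (fun t => lipschitzWith_firstOrder hK LipschitzWith.id t)
      (f := fun t => (u t, derivWithin u J t)) (g := fun t => (w t, derivWithin w J' t))
      (a := 0) (b := t)
      (fun r hr => (h.hasDerivWithinAt_prod hε (hsub hr)).continuousWithinAt.mono hsub)
      (fun r hr => by
        rw [clampedForce_of_mem (abs_le.1 (hR r (Ico_subset_Icc_self hr)).1)]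
        exact (h.hasDerivWithinAt_prod hε (hsub (Ico_subset_Icc_self hr))).mono_of_mem_nhdsWithin
          (mem_of_superset (Icc_mem_nhdsGE hr.2) ((Icc_subset_Icc_left hr.1).trans hsub)))
      (fun r hr => (h'.hasDerivWithinAt_prod hε (hJJ' (hsub hr))).continuousWithinAt.mono
        (hsub.trans hJJ'))
      (fun r hr => by
        rw [clampedForce_of_mem (abs_le.1 (hR r (Ico_subset_Icc_self hr)).2)]
        exact (h'.hasDerivWithinAt_prod hε
          (hJJ' (hsub (Ico_subset_Icc_self hr)))).mono_of_mem_nhdsWithin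
          (mem_of_superset (Icc_mem_nhdsGE hr.2)
            ((Icc_subset_Icc_left hr.1).trans (hsub.trans hJJ'))))
      hstart (right_mem_Icc.2 h0t)
    exact congrArg Prod.fst this
  · have hsub : Icc t 0 ⊆ J := hJ.out ht h0
    obtain ⟨R, hR⟩ := hcpt t 0 hsub
    obtain ⟨K, hK⟩ := exists_lipschitz_clampedForce (ε ^ 2) lam (-R) R
    have := ODE_solution_unique_of_mem_Icc_left (v := fun t (p : ℝ × ℝ) =>
        (p.2, clampedForce (ε ^ 2) lam (-R) R t p.1)) (s := fun _ => univ)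
      (fun t _ => (lipschitzWith_firstOrder hK LipschitzWith.id t).lipschitzOnWith)
      (f := fun t => (u t, derivWithin u J t)) (g := fun t => (w t, derivWithin w J' t))
      (a := t) (b := 0)
      (fun r hr => (h.hasDerivWithinAt_prod hε (hsub hr)).continuousWithinAt.mono hsub)
      (fun r hr => by
        rw [clampedForce_of_mem (abs_le.1 (hR r (Ioc_subset_Icc_self hr)).1)]
        exact (h.hasDerivWithinAt_prod hε (hsub (Ioc_subset_Icc_self hr))).mono_of_mem_nhdsWithin
          (mem_of_superset (Icc_mem_nhdsLE hr.1) ((Icc_subset_Icc_right hr.2).trans hsub)))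
      (fun _ _ => trivial)
      (fun r hr => (h'.hasDerivWithinAt_prod hε (hJJ' (hsub hr))).continuousWithinAt.mono
        (hsub.trans hJJ'))
      (fun r hr => by
        rw [clampedForce_of_mem (abs_le.1 (hR r (Ioc_subset_Icc_self hr)).2)]
        exact (h'.hasDerivWithinAt_prod hε
          (hJJ' (hsub (Ioc_subset_Icc_self hr)))).mono_of_mem_nhdsWithin
          (mem_of_superset (Icc_mem_nhdsLE hr.1)
            ((Icc_subset_Icc_right hr.2).trans (hsub.trans hJJ'))))
      (fun _ _ => trivial) hstart (left_mem_Icc.2 ht0)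
    exact congrArg Prod.fst this

end IsSolutionOn

theorem IsNeumannSolutionOn.neumannDuffing {ε lam : ℝ} {J : Set ℝ} {u : ℝ → ℝ}
    (h : IsNeumannSolutionOn ε lam J u) (hε : 0 < ε) (hJ : Icc 0 Real.pi ⊆ J) :
    NeumannDuffing (ε ^ 2) lam u (derivWithin u J) :=
  ⟨h.1.duffingOn hε hJ, h.2.1, h.2.2⟩

theorem exists_isUp {ε : ℝ} (lam : ℝ) (hε : 0 < ε) :
    ∃ u, IsUp ε lam u ∧ IsNeumannSolutionOn ε lam univ u := by
  obtain ⟨u, v, hu, hv, hper, hv0, hvπ, huπ, hpos⟩ :=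
    exists_symmetric_solution lam (pow_pos hε 2)
  obtain ⟨hsol, hEq⟩ := isSolutionOn_of_hasDerivAt hε uniqueDiffOn_univ
    (fun t _ => hu t) (fun t _ => hv t)
  refine ⟨u, ⟨hsol, hper, by rw [(hu 0).deriv, hv0], huπ, fun t ht => ?_⟩, hsol, ?_, ?_⟩
  · rw [(hu t).deriv]; exact hpos t ht
  · rw [hEq trivial, hv0]
  · rw [hEq trivial, hvπ]

/-- If all Neumann solutions have the same initial value, `u_p` is the only one. -/
theorem upIsOnlySolution_of_initial_eq {ε lam : ℝ} (hε : 0 < ε)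
    (h : ∀ u₁ v₁ u₂ v₂, NeumannDuffing (ε ^ 2) lam u₁ v₁ → NeumannDuffing (ε ^ 2) lam u₂ v₂ →
      u₁ 0 = u₂ 0) : UpIsOnlySolution ε lam := by
  obtain ⟨up, hup, hupN⟩ := exists_isUp lam hε
  refine ⟨up, hup, hupN, fun J hJ hJπ u hu => ?_⟩
  refine hu.1.eqOn hupN.1 hε hJ (hJπ (left_mem_Icc.2 Real.pi_pos.le)) (subset_univ _) ?_
    (hu.2.1.trans hupN.2.1.symm)
  exact h _ _ _ _ (hu.neumannDuffing hε hJπ) (hupN.neumannDuffing hε (subset_univ _))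

/-! ### The threshold λ₀ and the conclusion -/

theorem lambda0_pos : 0 < lambda0 := by rw [lambda0_eq]; positivity

theorem cubicP_neg_self (s : ℝ) : cubicP (3 * s ^ 2) (-s) = 2 * s ^ 3 := by
  unfold cubicP; ring

theorem exists_eq_three_mul_sq {lam : ℝ} (hlam : 0 < lam) :
    ∃ s, 0 < s ∧ lam = 3 * s ^ 2 ∧ √(lam / 3) = s := by
  refine ⟨√(lam / 3), Real.sqrt_pos.2 (by positivity), ?_, rfl⟩
  rw [Real.sq_sqrt (by positivity)]; ring

theorem two_mul_cube_lt_one {s : ℝ} (hs : 0 < s) (h : 3 * s ^ 2 < lambda0) : 2 * s ^ 3 < 1 := by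
  have hmem : lambda0 ∈ lambda0Set := by
    rw [lambda0_eq]; exact isGreatest_lambda0Set.1
  obtain ⟨σ, hσ, hσlam, hsqrt⟩ := exists_eq_three_mul_sq lambda0_pos
  obtain ⟨-, t, ht⟩ := hmem
  rw [hsqrt, hσlam, cubicP_neg_self] at ht
  rw [hσlam] at h
  have hsσ : s < σ := lt_of_pow_lt_pow_left₀ 2 hσ.le (by linarith)
  have := pow_lt_pow_left₀ hsσ hs.le (n := 3) (by norm_num)
  linarith [Real.abs_cos_le_one t]

theorem one_lt_two_mul_cube {s : ℝ} (hs : 0 < s) (h : lambda0 < 3 * s ^ 2) : 1 < 2 * s ^ 3 := by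
  by_contra! hle
  have hsqrt : √(3 * s ^ 2 / 3) = s := by
    rw [mul_div_cancel_left₀ _ (by norm_num)]; exact Real.sqrt_sq hs.le
  have hmem : 3 * s ^ 2 ∈ lambda0Set := by
    refine ⟨by positivity, 0, ?_⟩
    rw [hsqrt, cubicP_neg_self, Real.cos_zero, abs_one]
    exact hle
  have := isGreatest_lambda0Set.2 hmem
  rw [← lambda0_eq] at this
  linarith

theorem upIsOnlySolution_of_nonpos {ε lam : ℝ} (hε : 0 < ε) (hlam : lam ≤ 0) :
    UpIsOnlySolution ε lam :=
  upIsOnlySolution_of_initial_eq hε fun _ _ _ _ h₁ h₂ =>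
    h₁.initial_eq_of_nonpos h₂ (pow_pos hε 2) hlam

theorem eventually_upIsOnlySolution {lam : ℝ} (hlam : lam < lambda0) :
    ∀ᶠ ε in 𝓝[>] 0, UpIsOnlySolution ε lam := by
  rcases le_or_gt lam 0 with h0 | h0
  · filter_upwards [self_mem_nhdsWithin] with ε hε
    exact upIsOnlySolution_of_nonpos hε h0
  obtain ⟨s, hs, rfl, -⟩ := exists_eq_three_mul_sq h0
  obtain ⟨α, hα⟩ := exists_isLeftRoot hs (two_mul_cube_lt_one hs hlam)
  have htend : Tendsto (fun ε : ℝ => ε ^ 2) (𝓝[>] 0) (𝓝[>] 0) := by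
    refine tendsto_nhdsWithin_iff.2 ⟨tendsto_nhdsWithin_of_tendsto_nhds ?_, ?_⟩
    · simpa using (continuous_pow (M := ℝ) 2).tendsto 0
    · filter_upwards [self_mem_nhdsWithin] with ε hε
      exact pow_pos (mem_Ioi.1 hε) 2
  filter_upwards [htend.eventually hα.eventually_initial_eq, self_mem_nhdsWithin] with ε h hε
  exact upIsOnlySolution_of_initial_eq hε h

theorem le_lambda0_of_upIsOnlySolution {ε lam : ℝ} (hε : 0 < ε) (h : UpIsOnlySolution ε lam) :
    lam ≤ lambda0 := by
  by_contra! hlt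
  obtain ⟨s, hs, rfl, -⟩ := exists_eq_three_mul_sq (lambda0_pos.trans hlt)
  obtain ⟨u, v, hu, hv, hv0, hvπ, hneg⟩ :=
    exists_negative_solution (pow_pos hε 2) hs (one_lt_two_mul_cube hs hlt)
  obtain ⟨hsol, hEq⟩ := isSolutionOn_of_hasDerivAt hε (uniqueDiffOn_Icc Real.pi_pos)
    (fun t _ => hu t) hv
  have hπ := Real.pi_pos
  -- The negative solution is controlled only on `[0, π]`, so uniqueness is applied on that
  -- interval; it fails at π/2, where u_p vanishes.
  obtain ⟨up, hup, -, huniq⟩ := h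
  have := huniq (Icc 0 Real.pi) ordConnected_Icc subset_rfl u
    ⟨hsol, (hEq (left_mem_Icc.2 hπ.le)).trans hv0, (hEq (right_mem_Icc.2 hπ.le)).trans hvπ⟩
  have hmid : Real.pi / 2 ∈ Icc 0 Real.pi := ⟨by linarith, by linarith⟩
  have h1 := hneg _ hmid
  rw [this hmid, hup.2.2.2.1] at h1
  exact lt_irrefl _ h1

theorem isLUB_lambdaB {ε : ℝ} (hε : 0 < ε) : IsLUB (uniquenessSet ε) (lambdaB ε) :=
  isLUB_csSup ⟨0, upIsOnlySolution_of_nonpos hε le_rfl⟩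
    ⟨lambda0, fun _ h => le_lambda0_of_upIsOnlySolution hε h⟩

theorem mainTheorem10 :
    (∀ lam : ℝ, lam < lambda0 →
      ∃ ε₀ : ℝ, 0 < ε₀ ∧ ∀ ε : ℝ, 0 < ε → ε < ε₀ → UpIsOnlySolution ε lam) ∧
    (∀ ε : ℝ, 0 < ε → IsLUB (uniquenessSet ε) (lambdaB ε)) ∧
    Tendsto lambdaB (𝓝[>] 0) (𝓝 lambda0) := by
  refine ⟨fun lam hlam => ?_, fun ε hε => isLUB_lambdaB hε, ?_⟩
  · obtain ⟨ε₀, hε₀, h⟩ := mem_nhdsGT_iff_exists_Ioo_subset.1 (eventually_upIsOnlySolution hlam)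
    exact ⟨ε₀, hε₀, fun ε h0 h1 => h ⟨h0, h1⟩⟩
  -- The lower bound uses part (a) at some `b` between `a` and λ₀; the upper bound λ_b ≤ λ₀ holds
  -- for every ε.
  · refine tendsto_order.2 ⟨fun a ha => ?_, fun a ha => ?_⟩
    · obtain ⟨b, hab, hb⟩ := exists_between ha
      filter_upwards [eventually_upIsOnlySolution hb, self_mem_nhdsWithin] with ε h hε
      exact hab.trans_le ((isLUB_lambdaB hε).1 h)
    · filter_upwards [self_mem_nhdsWithin] with ε hε
      exact ((isLUB_lambdaB hε).2 fun _ h => le_lambda0_of_upIsOnlySolution hε h).trans_lt ha
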